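/- Let $D\ge 1$ be an integer, let $\varepsilon>0$, $a\in(0,1)$ and $e\in\{-1,1\}$, let $(b_n)_{n\ge1}$ be a sequence of positive integers, and let $(\alpha_n)_{n\ge1}$ be a sequence of complex algebraic integers with $|\alpha_n|\ge 1$ and $\alpha_n\ne -b_n$ for all $n$. For an algebraic number $\alpha$ let $\operatorname{house}(\alpha)$ denote the maximum modulus among the conjugates of $\alpha$ over $\mathbb{Q}$ (including $\alpha$ itself). Suppose that $$\operatorname{house}(\alpha_n)\,b_n\le|\alpha_n|\,2^{(\log_2|\alpha_n|)^a}\qquad\text{for all } n\ge1,$$ that $|\alpha_n|$ is non-decreasing in $n$, and that $|\alpha_n|>n^{1+\varepsilon}$ for all sufficiently large $n$. Suppose furthermore that $\bigl(\Re(\alpha_n/b_n)+\tfrac12\bigr)e\ge0$ for all $n\ge 1$, with strict inequality for infinitely many $n$. Put $\mathbb{K}_0=\mathbb{Q}$, $\mathbb{K}_{n+1}=\mathbb{K}_n(\alpha_{n+1})$, $d_n=\deg_{\mathbb{K}_{n-1}}\alpha_n$ and $D_n=\prod_{i=1}^n d_i$. Finally, suppose that the sequence $$|\alpha_n|^{1/\left(D^n\prod_{i=1}^{n-1}(D_i+d_i)\right)}$$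 diverges in $\mathbb{R}$ as $n\to\infty$, i.e. it does not converge to any real number (it may be unbounded, or bounded and oscillating). Let $\mathbb{K}=\mathbb{Q}(\alpha_1,\alpha_2,\ldots)$. Then the infinite product $\prod_{n=1}^\infty\left(1+\frac{b_n}{\alpha_n}\right)$ converges (unconditionally), and $$\deg_{\mathbb{K}}\left(\prod_{n=1}^\infty\left(1+\frac{b_n}{\alpha_n}\right)\right)>D,$$ where the degree is understood to be $\infty$ if the product is transcendental over $\mathbb{K}$. -/

import Mathlib

open Filter Topology

/-- The house of an algebraic number `x`: the maximum modulus among its conjugates over `ℚ`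
(a supremum over the finite set of complex roots of its minimal polynomial). -/
noncomputable def algHouse (x : ℂ) : ℝ :=
  sSup ((fun z : ℂ => ‖z‖) '' (minpoly ℚ x).rootSet ℂ)

open Classical in
/-- The degree of a complex number over a subfield of `ℂ`; it is `⊤` for a number that is
transcendental over the subfield. -/
noncomputable def degOver (F : IntermediateField ℚ ℂ) (x : ℂ) : ℕ∞ :=
  if IsAlgebraic F x then ((minpoly F x).natDegree : ℕ∞) else ⊤

/-- The tower `K 0 = ℚ`, `K (n + 1) = (K n)(α (n + 1))` of subfields of `ℂ`.
Sequences are indexed from `1`; the entry `α 0` is never used. -/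
noncomputable def towerField (α : ℕ → ℂ) : ℕ → IntermediateField ℚ ℂ
  | 0 => ⊥
  | n + 1 => (IntermediateField.adjoin (towerField α n) {α (n + 1)}).restrictScalars ℚ

/-- `d n`, the degree of `α n` over `K (n - 1)`, for `n ≥ 1`. It is used only for sequences of
algebraic numbers. -/
noncomputable def relDeg (α : ℕ → ℂ) (n : ℕ) : ℕ :=
  (minpoly (towerField α (n - 1)) (α n)).natDegree

/-- `D n = d 1 * ... * d n`. -/
noncomputable def totalDeg (α : ℕ → ℂ) (n : ℕ) : ℕ :=
  ∏ i ∈ Finset.Icc 1 n, relDeg α i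

/-- The field `ℚ(α 1, α 2, ...)`. -/
noncomputable def unionField (α : ℕ → ℂ) : IntermediateField ℚ ℂ :=
  IntermediateField.adjoin ℚ (α '' Set.Ici 1)

/-! Suppose the product P has degree at most D over 𝕂. Write l_n = log₂|α_n|, T_n for the exponent
in the statement (`growthExp`), and P_N for the partial products. For large N, P has degree at most
D over K_N, so clearing denominators in P - P_N gives an algebraic integer in a field of degree at
most D·D_N. It is nonzero, because the sign condition makes |P_N| monotone and infinitely often
strictly so. Its norm has modulus at least 1, which bounds |P - P_N| from below
(`exists_inv_pow_le_norm_sub`), while |P - P_N| is at most a constant times the tail of Σ b_n/|α_n|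
(`norm_tprod_sub_prod_le`). With the constants absorbed into c, 2^(-g_N) ≤ Σ_{n>N} b_n/|α_n|, where
g_N = D·D_N·Σ_{n≤N} (l_n + l_n^a + c) is `weightSum`.

If l_n ≥ n eventually, the tail is essentially 2^(-l_{N+1}), so l_{N+1} is at most g_N up to
lower-order errors. The ratio T_{N+2}/T_{N+1} is exactly what turns this into q_{N+1} ≤ (1+δ_N) q_N
+ δ_N for q_N = g_N/T_{N+1}; since T grows at least like 2^n, the δ_N are summable. Hence q_N
converges, then l_n/T_n, then |α_n|^(1/T_n), contradicting the divergence hypothesis.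

If l_n < n infinitely often, then l_n/T_n tends to 0. Otherwise l_k/T_k ≥ λ > 0 for some large k
beyond an index s with l_s < s. There q_s is tiny, and the same recursion keeps q small from the
last such s up to k - 1. So g_{k-1} is too small compared with l_k: the tail from k on, controlled
by |α_n| > n^(1+ε), falls below 2^(-g_{k-1}). -/

/-! ### Products of degrees and the growth exponents -/

/-- The product `d 1 * ... * d n`. -/
def degProd (d : ℕ → ℕ) (n : ℕ) : ℕ := ∏ i ∈ Finset.Icc 1 n, d i

/-- The exponent `D ^ n * ∏_{1 ≤ i < n} (d 1 * ... * d i + d i)`. -/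
noncomputable def growthExp (D : ℕ) (d : ℕ → ℕ) (n : ℕ) : ℝ :=
  (D : ℝ) ^ n * ∏ i ∈ Finset.Ico 1 n, ((degProd d i : ℝ) + (d i : ℝ))

/-- The weighted sum `D * (d 1 * ... * d N) * (p 1 + ... + p N)`. -/
noncomputable def weightSum (D : ℕ) (d : ℕ → ℕ) (p : ℕ → ℝ) (N : ℕ) : ℝ :=
  (D : ℝ) * degProd d N * ∑ n ∈ Finset.Icc 1 N, p n

lemma degProd_succ (d : ℕ → ℕ) (n : ℕ) : degProd d (n + 1) = degProd d n * d (n + 1) := by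
  rw [degProd, Finset.prod_Icc_succ_top (by omega), degProd]

lemma growthExp_succ (D : ℕ) (d : ℕ → ℕ) {n : ℕ} (hn : 1 ≤ n) :
    growthExp D d (n + 1) = growthExp D d n * (D * ((degProd d n : ℝ) + d n)) := by
  rw [growthExp, growthExp, Finset.prod_Ico_succ_top hn]
  ring

lemma weightSum_succ (D : ℕ) (d : ℕ → ℕ) (p : ℕ → ℝ) (N : ℕ) :
    weightSum D d p (N + 1) =
      d (N + 1) * weightSum D d p N + D * degProd d (N + 1) * p (N + 1) := by
  rw [weightSum, weightSum, Finset.sum_Icc_succ_top (by omega), degProd_succ]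
  push_cast
  ring

lemma weightSum_nonneg {D : ℕ} {d : ℕ → ℕ} {p : ℕ → ℝ} (hp : ∀ n, 1 ≤ n → 0 ≤ p n) (N : ℕ) :
    0 ≤ weightSum D d p N := by
  have : 0 ≤ ∑ n ∈ Finset.Icc 1 N, p n :=
    Finset.sum_nonneg fun i hi => hp i (Finset.mem_Icc.1 hi).1
  unfold weightSum
  positivity

section
variable {D : ℕ} {d : ℕ → ℕ} (hD : 1 ≤ D) (hd : ∀ n, 1 ≤ n → 1 ≤ d n)
include hd

lemma one_le_degProd (n : ℕ) : 1 ≤ degProd d n :=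
  Finset.one_le_prod' fun i hi => hd i (Finset.mem_Icc.1 hi).1

lemma le_degProd {n : ℕ} (hn : 1 ≤ n) : d n ≤ degProd d n := by
  obtain ⟨m, rfl⟩ : ∃ m, n = m + 1 := ⟨n - 1, by omega⟩
  rw [degProd_succ]
  exact Nat.le_mul_of_pos_left _ (one_le_degProd hd m)


include hD

lemma growthExp_pos (n : ℕ) : 0 < growthExp D d n := by
  refine mul_pos (by positivity) (Finset.prod_pos fun i hi => ?_)
  have : 0 < d i := hd i (Finset.mem_Ico.1 hi).1
  positivity

/-- The ratio is D(D_n + d_n) ≥ 2. The resulting exponential growth of T is what makes all sublinear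
errors summable. -/
lemma two_mul_growthExp_le {n : ℕ} (hn : 1 ≤ n) :
    2 * growthExp D d n ≤ growthExp D d (n + 1) := by
  rw [growthExp_succ D d hn, mul_comm]
  refine mul_le_mul_of_nonneg_left ?_ (growthExp_pos hD hd n).le
  have h1 : (1 : ℝ) ≤ degProd d n := by exact_mod_cast one_le_degProd hd n
  have h2 : (1 : ℝ) ≤ d n := by exact_mod_cast hd n hn
  have h3 : (1 : ℝ) ≤ D := by exact_mod_cast hD
  nlinarith

lemma growthExp_le {m n : ℕ} (hm : 1 ≤ m) (hmn : m ≤ n) :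
    growthExp D d m ≤ growthExp D d n := by
  induction n, hmn using Nat.le_induction with
  | base => rfl
  | succ n hn ih =>
    have := two_mul_growthExp_le hD hd (hm.trans hn)
    have := growthExp_pos hD hd n
    linarith

lemma two_pow_le_growthExp (n : ℕ) : (2 : ℝ) ^ n ≤ growthExp D d (n + 1) := by
  induction n with
  | zero => simpa [growthExp] using hD
  | succ n ih =>
    have := two_mul_growthExp_le hD hd (n := n + 1) (by omega)
    rw [pow_succ]
    linarith

lemma two_pow_mul_degProd_le_growthExp (n : ℕ) :
    (2 : ℝ) ^ n * (D * degProd d (n + 1)) ≤ growthExp D d (n + 2) := by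
  rw [growthExp_succ D d (by omega : 1 ≤ n + 1)]
  have := growthExp_pos hD hd (n + 1)
  refine mul_le_mul (two_pow_le_growthExp hD hd n) ?_ (by positivity) this.le
  exact mul_le_mul_of_nonneg_left (by simp) (by positivity)

/-- Passing from g_N to g_{N+1} adds a term weighted D·D_{N+1} to one weighted d_{N+1}; their sum is
at most the ratio D(D_{N+1} + d_{N+1}) of consecutive T's times the bound on p (N+1). -/
lemma weightSum_div_step {p : ℕ → ℝ} {N : ℕ} {δ : ℝ} (hδ : 0 ≤ δ)
    (hg : 0 ≤ weightSum D d p N)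
    (hp : p (N + 1) ≤ (1 + δ) * weightSum D d p N + δ * growthExp D d (N + 1)) :
    weightSum D d p (N + 1) / growthExp D d (N + 2) ≤
      (1 + δ) * (weightSum D d p N / growthExp D d (N + 1)) + δ := by
  have hT := growthExp_pos hD hd (N + 1)
  have h1 : (1 : ℝ) ≤ degProd d (N + 1) := by exact_mod_cast one_le_degProd hd (N + 1)
  have h2 : (1 : ℝ) ≤ d (N + 1) := by exact_mod_cast hd (N + 1) (by omega)
  have h3 : (1 : ℝ) ≤ D := by exact_mod_cast hD
  rw [div_le_iff₀ (growthExp_pos hD hd _), growthExp_succ D d (by omega : 1 ≤ N + 1),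
    weightSum_succ]
  set G := weightSum D d p N
  set T := growthExp D d (N + 1)
  set E : ℝ := (degProd d (N + 1) : ℝ)
  set c : ℝ := (d (N + 1) : ℝ)
  have e1 : ((1 + δ) * (G / T) + δ) * (T * (D * (E + c))) =
      ((1 + δ) * G + δ * T) * (D * (E + c)) := by
    field_simp
  rw [e1]
  have h4 : D * E * p (N + 1) ≤ D * E * ((1 + δ) * G + δ * T) :=
    mul_le_mul_of_nonneg_left hp (by positivity)
  have h5 : c * G ≤ D * c * ((1 + δ) * G + δ * T) := by
    have : G ≤ (1 + δ) * G + δ * T := by nlinarith [mul_nonneg hδ hg, mul_nonneg hδ hT.le]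
    calc c * G ≤ c * ((1 + δ) * G + δ * T) := by gcongr
      _ ≤ D * (c * ((1 + δ) * G + δ * T)) := le_mul_of_one_le_left (by positivity) h3
      _ = _ := by ring
  linarith

/-- A converse to the step estimate: q_{N+1} is a weighted combination of q_N and p_{N+1}/T_{N+1},
and since d_{N+1} ≤ D_{N+1} the weight on q_N costs at most |q_{N+1} - q_N|. Convergence of q thus
passes to p/T. -/
lemma le_div_growthExp {p : ℕ → ℝ} {N : ℕ} (hg : 0 ≤ weightSum D d p N) :
    weightSum D d p (N + 1) / growthExp D d (N + 2)
      - |weightSum D d p (N + 1) / growthExp D d (N + 2)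
          - weightSum D d p N / growthExp D d (N + 1)|
      ≤ p (N + 1) / growthExp D d (N + 1) := by
  have hT := growthExp_pos hD hd (N + 1)
  have h1 : (1 : ℝ) ≤ degProd d (N + 1) := by exact_mod_cast one_le_degProd hd (N + 1)
  have h2 : (1 : ℝ) ≤ d (N + 1) := by exact_mod_cast hd (N + 1) (by omega)
  have h3 : (1 : ℝ) ≤ D := by exact_mod_cast hD
  have h4 : (d (N + 1) : ℝ) ≤ degProd d (N + 1) := by exact_mod_cast le_degProd hd (by omega)
  have key := weightSum_succ D d p N
  have hT2 := growthExp_succ D d (by omega : 1 ≤ N + 1)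
  set G := weightSum D d p N
  set G' := weightSum D d p (N + 1)
  set T := growthExp D d (N + 1)
  set E : ℝ := (degProd d (N + 1) : ℝ)
  set c : ℝ := (d (N + 1) : ℝ)
  set q := G / T
  have hq : 0 ≤ q := div_nonneg hg hT.le
  set q' := G' / growthExp D d (N + 2)
  have e1 : D * (E + c) * q' = c * q + D * E * (p (N + 1) / T) := by
    have hc : E + c ≠ 0 := by positivity
    simp only [q', q]
    rw [hT2, key]
    field_simp
  have h6 : D * (c * (q - q')) ≤ D * (E * |q' - q|) := by
    refine mul_le_mul_of_nonneg_left ?_ (by positivity)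
    calc c * (q - q') ≤ c * |q' - q| := by
          gcongr; rw [abs_sub_comm]; exact le_abs_self _
      _ ≤ _ := by gcongr
  have h7 : c * q ≤ D * (c * q) := le_mul_of_one_le_left (by positivity) h3
  have h8 : 0 < D * E := by positivity
  refine le_of_mul_le_mul_left (a := D * E) ?_ h8
  nlinarith

end

/-! ### Sequences with multiplicatively summable increments -/

lemma le_exp_sum_mul {Y δ : ℕ → ℝ} {s k : ℕ} (hsk : s ≤ k) (hY : ∀ n, 0 ≤ Y n)
    (h : ∀ n, s ≤ n → n < k → Y (n + 1) ≤ (1 + δ n) * Y n) :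
    Y k ≤ Real.exp (∑ i ∈ Finset.Ico s k, δ i) * Y s := by
  induction k, hsk using Nat.le_induction with
  | base => simp
  | succ k hk ih =>
    rw [Finset.sum_Ico_succ_top hk, Real.exp_add]
    calc Y (k + 1) ≤ (1 + δ k) * Y k := h k hk (by omega)
      _ ≤ Real.exp (δ k) * Y k := by
          gcongr
          · exact hY k
          · linarith [Real.add_one_le_exp (δ k)]
      _ ≤ Real.exp (δ k) * (Real.exp (∑ i ∈ Finset.Ico s k, δ i) * Y s) := by
          gcongr
          exact ih fun n h1 h2 => h n h1 (by omega)
      _ = _ := by ring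

/-- Dividing Y by the exponential of the partial sums of δ gives a nonincreasing nonnegative
sequence. -/
lemma exists_tendsto_of_le_mul {Y δ : ℕ → ℝ} {M : ℕ} (hY : ∀ n, 0 ≤ Y n) (hδ : Summable δ)
    (h : ∀ n, M ≤ n → Y (n + 1) ≤ (1 + δ n) * Y n) : ∃ L, Tendsto Y atTop (𝓝 L) := by
  set Z : ℕ → ℝ := fun n => Real.exp (-∑ i ∈ Finset.range (n + M), δ i) * Y (n + M) with hZ
  have hanti : Antitone Z := by
    refine antitone_nat_of_succ_le fun n => ?_
    have h1 := h (n + M) (by omega)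
    have h2 : Y (n + M + 1) ≤ Real.exp (δ (n + M)) * Y (n + M) :=
      h1.trans (mul_le_mul_of_nonneg_right (by linarith [Real.add_one_le_exp (δ (n + M))]) (hY _))
    simp only [hZ]
    rw [show n + 1 + M = n + M + 1 by ring, Finset.sum_range_succ, neg_add, Real.exp_add, mul_assoc]
    refine mul_le_mul_of_nonneg_left ?_ (Real.exp_pos _).le
    calc Real.exp (-δ (n + M)) * Y (n + M + 1)
        ≤ Real.exp (-δ (n + M)) * (Real.exp (δ (n + M)) * Y (n + M)) := by gcongr
      _ = Y (n + M) := by rw [← mul_assoc, ← Real.exp_add]; simp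
  have hlim := tendsto_atTop_ciInf hanti
    ⟨0, by rintro _ ⟨n, rfl⟩; exact mul_nonneg (Real.exp_pos _).le (hY _)⟩
  have hS := (hδ.hasSum.tendsto_sum_nat.comp (tendsto_add_atTop_nat M)).rexp
  refine ⟨_, (tendsto_add_atTop_iff_nat M).1 ((hS.mul hlim).congr fun n => ?_)⟩
  simp only [hZ, Function.comp]
  rw [← mul_assoc, ← Real.exp_add]
  simp

/-! ### Estimates for fractional powers -/

/-- Split at x = ω^r: below the threshold x^a ≤ ω^r, above it x^(a-1) is at most its value at ω^r.
-/
lemma rpow_le_pow_mul_add {a ω x : ℝ} (ha : a ∈ Set.Ioo (0 : ℝ) 1) (hω : 1 ≤ ω) (hx : 0 ≤ x)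
    (r : ℕ) : x ^ a ≤ (ω ^ (a - 1)) ^ r * x + ω ^ r := by
  have hω0 : 0 < ω := by linarith
  have h1 : 1 ≤ ω ^ r := one_le_pow₀ hω
  rcases le_total x (ω ^ r) with h | h
  · have : x ^ a ≤ ω ^ r := calc
      x ^ a ≤ (ω ^ r) ^ a := Real.rpow_le_rpow hx h ha.1.le
      _ ≤ (ω ^ r) ^ (1 : ℝ) := Real.rpow_le_rpow_of_exponent_le h1 ha.2.le
      _ = ω ^ r := Real.rpow_one _
    have : 0 ≤ (ω ^ (a - 1)) ^ r * x := by positivity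
    linarith
  · have hx0 : 0 < x := by linarith
    have e1 : x ^ a = x ^ (a - 1) * x := by
      rw [Real.rpow_sub_one hx0.ne']; field_simp
    have e2 : x ^ (a - 1) ≤ (ω ^ r) ^ (a - 1) :=
      Real.rpow_le_rpow_of_nonpos (by positivity) h (by linarith [ha.2])
    have e3 : (ω ^ r) ^ (a - 1) = (ω ^ (a - 1)) ^ r := by
      rw [← Real.rpow_natCast, ← Real.rpow_natCast, ← Real.rpow_mul hω0.le, ← Real.rpow_mul hω0.le,
        mul_comm]
    rw [e3] at e2
    rw [e1]
    have := mul_le_mul_of_nonneg_right e2 hx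
    linarith

lemma exists_summable_rpow_add_le {a c : ℝ} (ha : a ∈ Set.Ioo (0 : ℝ) 1) (hc : 0 ≤ c) :
    ∃ δ : ℕ → ℝ, Summable δ ∧ (∀ r, 0 ≤ δ r) ∧
      ∀ (r : ℕ) (x T : ℝ), 0 ≤ x → 2 ^ r ≤ T → x ^ a + c ≤ δ r * (x + T) := by
  set ρ : ℝ := (3 / 2 : ℝ) ^ (a - 1)
  have hρ0 : 0 < ρ := by positivity
  have hρ1 : ρ < 1 := Real.rpow_lt_one_of_one_lt_of_neg (by norm_num) (by linarith [ha.2])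
  -- Any base ω strictly between 1 and 2 works: with ω = 3/2, both ω^(a-1) < 1 and ω^r/T ≤ (3/4)^r
  -- are summable.
  refine ⟨fun r => ρ ^ r + (1 + c) * (3 / 4) ^ r, ?_, fun r => by positivity, ?_⟩
  · exact (summable_geometric_of_lt_one hρ0.le hρ1).add
      ((summable_geometric_of_lt_one (by norm_num) (by norm_num)).mul_left _)
  · intro r x T hx hT
    have h1 := rpow_le_pow_mul_add (ω := 3 / 2) ha (by norm_num) hx r
    have h2 : (3 / 2 : ℝ) ^ r ≤ (3 / 4) ^ r * T := calc
      (3 / 2 : ℝ) ^ r = (3 / 4) ^ r * 2 ^ r := by rw [← mul_pow]; norm_num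
      _ ≤ _ := by gcongr
    have h3 : (1 : ℝ) ≤ (3 / 2 : ℝ) ^ r := one_le_pow₀ (by norm_num)
    have hT0 : 0 ≤ T := le_trans (by positivity) hT
    have h4 : c ≤ c * ((3 / 4) ^ r * T) := le_mul_of_one_le_right hc (h3.trans h2)
    have h5 : 0 ≤ ρ ^ r * T := by positivity
    have h6 : 0 ≤ (1 + c) * (3 / 4) ^ r * x := by positivity
    calc x ^ a + c ≤ ρ ^ r * x + (3 / 4) ^ r * T + c * ((3 / 4) ^ r * T) := by linarith
      _ ≤ ρ ^ r * x + (3 / 4) ^ r * T + c * ((3 / 4) ^ r * T) + ρ ^ r * T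
          + (1 + c) * (3 / 4) ^ r * x := by linarith
      _ = _ := by ring

lemma exists_rpow_le_mul_add {a κ : ℝ} (ha : a ∈ Set.Ioo (0 : ℝ) 1) (hκ : 0 < κ) :
    ∃ K : ℝ, 0 ≤ K ∧ ∀ x : ℝ, 0 ≤ x → x ^ a ≤ κ * x + K := by
  obtain ⟨δ, hδ, hδ0, h⟩ := exists_summable_rpow_add_le ha le_rfl
  obtain ⟨r, hr⟩ := (hδ.tendsto_atTop_zero.eventually_le_const hκ).exists
  refine ⟨κ * 2 ^ r, by positivity, fun x hx => ?_⟩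
  have := h r x (2 ^ r) hx le_rfl
  have h2 : δ r * (x + 2 ^ r) ≤ κ * (x + 2 ^ r) := by gcongr
  linarith

/-- The hypothesis leaves an error 3x^a + C + c over G. It also forces x = O(G + 1), so this
sublinear error is a summable multiple of G + T. -/
lemma exists_summable_step {a c C : ℝ} (ha : a ∈ Set.Ioo (0 : ℝ) 1) (hc : 0 ≤ c) (hC : 0 ≤ C) :
    ∃ δ : ℕ → ℝ, Summable δ ∧ (∀ r, 0 ≤ δ r) ∧
      ∀ (r : ℕ) (x G T : ℝ), 0 ≤ x → 0 ≤ G → 2 ^ r ≤ T → x - 2 * x ^ a ≤ G + C →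
        x + x ^ a + c ≤ (1 + δ r) * G + δ r * T := by
  obtain ⟨δ, hδ, hδ0, h⟩ := exists_summable_rpow_add_le (c := C + c) ha (by positivity)
  obtain ⟨K, hK, hKx⟩ := exists_rpow_le_mul_add ha (κ := 1 / 4) (by norm_num)
  set C2 := 2 * C + 4 * K
  have hC2 : 0 ≤ C2 := by positivity
  refine ⟨fun r => 3 * (C2 + 2) * δ r, hδ.mul_left _,
    fun r => mul_nonneg (by positivity) (hδ0 r), ?_⟩
  intro r x G T hx hG hT hxG
  have h1 := h r x T hx hT
  have h2 := hKx x hx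
  have h3 : x ≤ 2 * G + C2 := by simp only [C2]; linarith
  have hT1 : 1 ≤ T := le_trans (one_le_pow₀ (by norm_num)) hT
  have h4 : x + T ≤ (C2 + 2) * (G + T) := by nlinarith [mul_nonneg hC2 hG, mul_nonneg hC2 hG]
  have h5 : δ r * (x + T) ≤ δ r * ((C2 + 2) * (G + T)) := mul_le_mul_of_nonneg_left h4 (hδ0 r)
  nlinarith

lemma summable_two_rpow_neg_rpow {a : ℝ} (ha : 0 < a) :
    Summable fun n : ℕ => (2 : ℝ) ^ (-(n : ℝ) ^ a) := by
  have h1 := (isLittleO_log_rpow_atTop ha).bound (c := Real.log 2 / 2)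
    (by have := Real.log_pos (one_lt_two); positivity)
  have h2 := tendsto_natCast_atTop_atTop (R := ℝ) |>.eventually h1
  have h3 : Summable fun n : ℕ => ((n : ℝ) ^ (2 : ℝ))⁻¹ :=
    Real.summable_nat_rpow_inv.2 (by norm_num)
  refine h3.of_norm_bounded_eventually_nat ?_
  filter_upwards [h2, eventually_ge_atTop 1] with n hn hn1
  have hn0 : (0 : ℝ) < n := by exact_mod_cast hn1
  rw [Real.norm_of_nonneg (Real.log_nonneg (by exact_mod_cast hn1)),
    Real.norm_of_nonneg (by positivity)] at hn
  rw [Real.norm_of_nonneg (by positivity), ← Real.rpow_neg hn0.le,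
    Real.rpow_def_of_pos two_pos, Real.rpow_def_of_pos hn0 (-2)]
  apply Real.exp_le_exp.2
  linarith

/-- The bound for terms with l_n ≥ n. By subadditivity 2t^a ≤ 2x^a + 2(t-x)^a, and the last term is
absorbed by t - x; the spare t^a ≥ n^a supplies the summable factor. -/
lemma exists_two_rpow_le_of_natCast_le {a : ℝ} (ha : a ∈ Set.Ioo (0 : ℝ) 1) :
    ∃ K : ℝ, ∀ (n : ℕ) (x t : ℝ), 0 ≤ x → x ≤ t → (n : ℝ) ≤ t →
      (2 : ℝ) ^ (t ^ a - t) ≤ 2 ^ (K - (x - 2 * x ^ a)) * 2 ^ (-(n : ℝ) ^ a) := by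
  obtain ⟨K, hK, hKx⟩ := exists_rpow_le_mul_add ha (κ := 1 / 2) (by norm_num)
  refine ⟨2 * K, fun n x t hx hxt hnt => ?_⟩
  rw [← Real.rpow_add two_pos]
  apply Real.rpow_le_rpow_of_exponent_le one_le_two
  have h1 : (n : ℝ) ^ a ≤ t ^ a := Real.rpow_le_rpow (by positivity) hnt ha.1.le
  have h2 := Real.rpow_add_le_add_rpow hx (sub_nonneg.2 hxt) ha.1.le ha.2.le
  rw [add_sub_cancel] at h2
  have h3 := hKx (t - x) (sub_nonneg.2 hxt)
  linarith

lemma exists_two_rpow_le_of_logb_le {a ε : ℝ} (ha : a ∈ Set.Ioo (0 : ℝ) 1) (hε : 0 < ε) :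
    ∃ K μ : ℝ, 0 < μ ∧ ∀ (n : ℕ) (x t : ℝ), 1 ≤ n → 0 ≤ x → x ≤ t →
      (1 + ε) * Real.logb 2 n ≤ t →
      (2 : ℝ) ^ (t ^ a - t) ≤ 2 ^ (K - μ * x) * ((n : ℝ) ^ (1 + ε / 2))⁻¹ := by
  -- Chosen so that (1 - 2μ)(1 + ε) = 1 + ε/2: one μt absorbs t^a, another gives the decay in x, and
  -- the rest still yields a convergent series in n.
  set μ := ε / (4 * (1 + ε)) with hμ
  have hμ0 : 0 < μ := by positivity
  obtain ⟨K, hK, hKx⟩ := exists_rpow_le_mul_add ha hμ0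
  refine ⟨K, μ, hμ0, fun n x t hn hx hxt hnt => ?_⟩
  have hn0 : (0 : ℝ) < n := by exact_mod_cast hn
  have e1 : ((n : ℝ) ^ (1 + ε / 2))⁻¹ = 2 ^ (-((1 + ε / 2) * Real.logb 2 n)) := by
    rw [Real.rpow_neg two_pos.le, mul_comm, Real.rpow_mul two_pos.le,
      Real.rpow_logb two_pos (by norm_num) hn0]
  rw [e1, ← Real.rpow_add two_pos]
  apply Real.rpow_le_rpow_of_exponent_le one_le_two
  have h1 := hKx t (hx.trans hxt)
  have e2 : (1 - 2 * μ) * (1 + ε) = 1 + ε / 2 := by rw [hμ]; field_simp; ring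
  have h2 : 0 ≤ 1 - 2 * μ := by
    rw [hμ, sub_nonneg, ← mul_div_assoc, div_le_one (by positivity)]; linarith
  have h3 := mul_le_mul_of_nonneg_left hnt h2
  rw [← mul_assoc, e2] at h3
  have h4 : μ * x ≤ μ * t := by gcongr
  linarith

/-! ### Tails of series -/

lemma tsum_tail_le {β u v : ℕ → ℝ} {X Z : ℝ} {r : ℕ} (hX : 0 ≤ X) (hZ : 0 ≤ Z)
    (hu : Summable u) (hv : Summable v) (hu0 : ∀ n, 0 ≤ u n) (hv0 : ∀ n, 0 ≤ v n)
    (hβ0 : ∀ n, r < n → 0 ≤ β n) (hβ : ∀ n, r < n → β n ≤ X * u n + Z * v n) :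
    ∑' n, β (n + r + 1) ≤ X * (∑' n, u n) + Z * ∑' n, v n := by
  have hs : Summable fun n => X * u n + Z * v n := (hu.mul_left X).add (hv.mul_left Z)
  have hs' : Summable fun n => X * u (n + r + 1) + Z * v (n + r + 1) := by
    simpa only [add_assoc] using (summable_nat_add_iff (r + 1)).2 hs
  have hb : ∀ n, β (n + r + 1) ≤ X * u (n + r + 1) + Z * v (n + r + 1) :=
    fun n => hβ _ (by omega)
  calc ∑' n, β (n + r + 1) ≤ ∑' n, (X * u (n + r + 1) + Z * v (n + r + 1)) :=
        (Summable.of_nonneg_of_le (fun n => hβ0 _ (by omega)) hb hs').tsum_le_tsum hb hs'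
    _ ≤ ∑' n, (X * u n + Z * v n) := by
        have := hs.sum_add_tsum_nat_add (r + 1)
        have h0 : 0 ≤ ∑ i ∈ Finset.range (r + 1), (X * u i + Z * v i) :=
          Finset.sum_nonneg fun i _ => by have := hu0 i; have := hv0 i; positivity
        simp only [← add_assoc] at this
        linarith
    _ = _ := by rw [(hu.mul_left X).tsum_add (hv.mul_left Z), tsum_mul_left, tsum_mul_left]

/-! ### The growth dichotomy -/

lemma exists_le_or_le {U V : ℝ} (hU : 0 ≤ U) (hV : 0 ≤ V) :
    ∃ C : ℝ, 0 ≤ C ∧ ∀ A B g : ℝ, (2 : ℝ) ^ (-g) ≤ 2 ^ (-A) * U + 2 ^ (-B) * V →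
      A ≤ g + C ∨ B ≤ g + C := by
  obtain ⟨C, hC⟩ := pow_unbounded_of_one_lt (U + V) (one_lt_two (α := ℝ))
  refine ⟨C, by positivity, fun A B g h => ?_⟩
  by_contra! hcon
  have hA : (2 : ℝ) ^ (-A) ≤ 2 ^ (-(g + C)) :=
    Real.rpow_le_rpow_of_exponent_le one_le_two (by linarith [hcon.1])
  have hB : (2 : ℝ) ^ (-B) ≤ 2 ^ (-(g + C)) :=
    Real.rpow_le_rpow_of_exponent_le one_le_two (by linarith [hcon.2])
  have h1 : (2 : ℝ) ^ (-g) ≤ 2 ^ (-(g + C)) * (U + V) := calc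
    (2 : ℝ) ^ (-g) ≤ _ := h
    _ ≤ 2 ^ (-(g + C)) * U + 2 ^ (-(g + C)) * V := by gcongr
    _ = _ := by ring
  have h2 : (2 : ℝ) ^ (-(g + C)) * 2 ^ C = 2 ^ (-g) := by
    rw [← Real.rpow_natCast, ← Real.rpow_add two_pos]; congr 1; ring
  have h3 : (2 : ℝ) ^ (-(g + C)) * (U + V) < 2 ^ (-(g + C)) * 2 ^ C := by gcongr
  linarith

section
variable {ε a : ℝ} {l β g : ℕ → ℝ}

/-- Terms with l_n ≥ n decay like 2^(-l_{r+1}) up to lower order, the others only like 2^(-μ l). The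
three clauses treat a tail regular throughout, one regular up to k, and one with no regularity. -/
lemma exists_tail_dichotomy (hε : 0 < ε) (ha : a ∈ Set.Ioo (0 : ℝ) 1)
    (hl0 : ∀ n, 1 ≤ n → 0 ≤ l n) (hmono : MonotoneOn l (Set.Ici 1))
    (hgrowth : ∀ᶠ n : ℕ in atTop, (1 + ε) * Real.logb 2 n ≤ l n)
    (hβ0 : ∀ n, 1 ≤ n → 0 ≤ β n) (hβ : ∀ n, 1 ≤ n → β n ≤ (2 : ℝ) ^ (l n ^ a - l n))
    (hlow : ∀ᶠ N : ℕ in atTop, (2 : ℝ) ^ (-g N) ≤ ∑' n, β (n + N + 1)) :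
    ∃ C μ : ℝ, 0 ≤ C ∧ 0 < μ ∧ ∀ᶠ r : ℕ in atTop,
      ((∀ n : ℕ, r < n → (n : ℝ) ≤ l n) → l (r + 1) - 2 * l (r + 1) ^ a ≤ g r + C) ∧
      (∀ k, r < k → (∀ n : ℕ, r < n → n < k → (n : ℝ) ≤ l n) →
        l (r + 1) - 2 * l (r + 1) ^ a ≤ g r + C ∨ μ * l k ≤ g r + C) ∧
      μ * l (r + 1) ≤ g r + C := by
  obtain ⟨K₁, hK₁⟩ := exists_two_rpow_le_of_natCast_le ha
  obtain ⟨K₂, μ, hμ, hK₂⟩ := exists_two_rpow_le_of_logb_le ha hε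
  set u : ℕ → ℝ := fun n => (2 : ℝ) ^ (-(n : ℝ) ^ a) with hu
  set v : ℕ → ℝ := fun n => ((n : ℝ) ^ (1 + ε / 2))⁻¹ with hv
  have hus : Summable u := summable_two_rpow_neg_rpow ha.1
  have hvs : Summable v := Real.summable_nat_rpow_inv.2 (by linarith)
  have hu0 : ∀ n, 0 ≤ u n := fun n => by positivity
  have hv0 : ∀ n, 0 ≤ v n := fun n => by positivity
  obtain ⟨C, hC0, hC⟩ := exists_le_or_le (U := 2 ^ K₁ * ∑' n, u n) (V := 2 ^ K₂ * ∑' n, v n)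
    (mul_nonneg (by positivity) (tsum_nonneg hu0)) (mul_nonneg (by positivity) (tsum_nonneg hv0))
  have hU0 : 0 ≤ 2 ^ K₁ * ∑' n, u n := mul_nonneg (by positivity) (tsum_nonneg hu0)
  have hV0 : 0 ≤ 2 ^ K₂ * ∑' n, v n := mul_nonneg (by positivity) (tsum_nonneg hv0)
  have split : ∀ K x : ℝ, (2 : ℝ) ^ (K - x) = 2 ^ (-x) * 2 ^ K := fun K x => by
    rw [← Real.rpow_add two_pos]; congr 1; ring
  obtain ⟨M, hM⟩ := eventually_atTop.1 hgrowth
  refine ⟨C, μ, hC0, hμ, ?_⟩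
  filter_upwards [hlow, eventually_ge_atTop M] with r hr hrM
  have hle : ∀ n, r < n → l (r + 1) ≤ l n := fun n hn =>
    hmono (Set.mem_Ici.2 (by omega)) (Set.mem_Ici.2 (by omega)) (by omega)
  have hA : ∀ n, r < n → (n : ℝ) ≤ l n →
      β n ≤ 2 ^ (K₁ - (l (r + 1) - 2 * l (r + 1) ^ a)) * u n := fun n hn h =>
    (hβ n (by omega)).trans (hK₁ n _ _ (hl0 _ (by omega)) (hle n hn) h)
  have hB : ∀ n k, r < k → k ≤ n → β n ≤ 2 ^ (K₂ - μ * l k) * v n := fun n k hrk hkn =>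
    (hβ n (by omega)).trans (hK₂ n _ _ (by omega) (hl0 _ (by omega))
      (hmono (Set.mem_Ici.2 (by omega)) (Set.mem_Ici.2 (by omega)) hkn) (hM n (by omega)))
  have hβ0' : ∀ n, r < n → 0 ≤ β n := fun n hn => hβ0 n (by omega)
  refine ⟨fun h => ?_, fun k hrk h => ?_, ?_⟩
  · have := tsum_tail_le (r := r) (by positivity) le_rfl hus hvs hu0 hv0 hβ0'
      (fun n hn => (hA n hn (h n hn)).trans (le_add_of_nonneg_right (by simp)))
    rw [split, mul_assoc, zero_mul, add_zero] at this
    exact (or_self_iff).1 (hC _ _ _ ((hr.trans this).trans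
      (le_add_of_nonneg_right (mul_nonneg (by positivity) hV0))))
  · have := tsum_tail_le (r := r) (X := 2 ^ (K₁ - (l (r + 1) - 2 * l (r + 1) ^ a)))
      (Z := 2 ^ (K₂ - μ * l k)) (by positivity) (by positivity) hus hvs hu0 hv0 hβ0'
      (fun n hn => by
        rcases lt_or_ge n k with hnk | hnk
        · exact (hA n hn (h n hn hnk)).trans
            (le_add_of_nonneg_right (mul_nonneg (by positivity) (hv0 n)))
        · exact (hB n k hrk hnk).trans
            (le_add_of_nonneg_left (mul_nonneg (by positivity) (hu0 n))))
    rw [split, split, mul_assoc, mul_assoc] at this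
    exact hC _ _ _ (hr.trans this)
  · have := tsum_tail_le (r := r) le_rfl (by positivity) hus hvs hu0 hv0 hβ0'
      (fun n hn => (hB n (r + 1) (by omega) (by omega)).trans (le_add_of_nonneg_left (by simp)))
    rw [split, mul_assoc, zero_mul, zero_add] at this
    exact (or_self_iff).1 (hC _ _ _ ((hr.trans this).trans
      (le_add_of_nonneg_left (mul_nonneg (by positivity) hU0))))

end

/-! ### Convergence of l_n / T_n -/

section
variable {D : ℕ} {d : ℕ → ℕ} {a c : ℝ} {l : ℕ → ℝ}

lemma exists_tendsto_div_growthExp_of_step (hD : 1 ≤ D) (hd : ∀ n, 1 ≤ n → 1 ≤ d n)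
    (ha : a ∈ Set.Ioo (0 : ℝ) 1) (hc : 0 ≤ c) (hl0 : ∀ n, 1 ≤ n → 0 ≤ l n)
    {p δ : ℕ → ℝ} (hp : p = fun n => l n + l n ^ a + c) (hδ : Summable δ) (hδ0 : ∀ r, 0 ≤ δ r)
    (h : ∀ᶠ N in atTop,
      p (N + 1) ≤ (1 + δ N) * weightSum D d p N + δ N * growthExp D d (N + 1)) :
    ∃ L : ℝ, Tendsto (fun n => l n / growthExp D d n) atTop (𝓝 L) := by
  have hp0 : ∀ n, 1 ≤ n → 0 ≤ p n := fun n hn => by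
    have := hl0 n hn
    rw [hp]; positivity
  have hg0 : ∀ N, 0 ≤ weightSum D d p N := weightSum_nonneg hp0
  have hT0 := growthExp_pos hD hd
  set q : ℕ → ℝ := fun N => weightSum D d p N / growthExp D d (N + 1) with hq
  have hq0 : ∀ N, 0 ≤ q N := fun N => div_nonneg (hg0 N) (hT0 _).le
  obtain ⟨M, hM⟩ := eventually_atTop.1 h
  obtain ⟨L, hL⟩ := exists_tendsto_of_le_mul (Y := fun N => 1 + q N) (δ := δ) (M := M)
    (fun N => by linarith [hq0 N]) hδ (fun N hN => by
      have := weightSum_div_step hD hd (hδ0 N) (hg0 N) (hM N hN)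
      change q (N + 1) ≤ (1 + δ N) * q N + δ N at this
      linarith)
  have hqL : Tendsto q atTop (𝓝 (L - 1)) := by
    simpa using hL.sub_const 1
  have hδt := hδ.tendsto_atTop_zero
  have hq1 : Tendsto (fun N => q (N + 1)) atTop (𝓝 (L - 1)) :=
    hqL.comp (tendsto_add_atTop_nat 1)
  have hpL : Tendsto (fun N => p (N + 1) / growthExp D d (N + 1)) atTop (𝓝 (L - 1)) := by
    refine tendsto_of_tendsto_of_tendsto_of_le_of_le'
      (g := fun N => q (N + 1) - |q (N + 1) - q N|) (h := fun N => (1 + δ N) * q N + δ N) ?_ ?_ ?_ ?_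
    · simpa using hq1.sub ((hq1.sub hqL).abs)
    · simpa using ((hδt.const_add 1).mul hqL).add hδt
    · exact Eventually.of_forall fun N => le_div_growthExp hD hd (hg0 N)
    · filter_upwards [h] with N hN
      rw [div_le_iff₀ (hT0 _)]
      simp only [hq]
      have := (hT0 (N + 1)).ne'
      field_simp
      linarith
  obtain ⟨η, hη, hη0, hηb⟩ := exists_summable_rpow_add_le ha hc
  have herr : Tendsto (fun N => (l (N + 1) ^ a + c) / growthExp D d (N + 1)) atTop (𝓝 0) := by
    -- The lower-order part of p is negligible against T, so p/T and l/T have the same limit.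
    refine squeeze_zero (g := fun N => η N * (p (N + 1) / growthExp D d (N + 1) + 1))
      (fun N => ?_) (fun N => ?_) ?_
    · have := hl0 (N + 1) (by omega)
      have := hT0 (N + 1)
      positivity
    · have h0 := hl0 (N + 1) (by omega)
      have hlp : l (N + 1) ≤ p (N + 1) := by
        rw [hp]
        have : 0 ≤ l (N + 1) ^ a := by positivity
        simp only
        linarith
      have hT := hT0 (N + 1)
      rw [div_le_iff₀ hT]
      calc _ ≤ η N * (l (N + 1) + growthExp D d (N + 1)) :=
            hηb N _ _ h0 (two_pow_le_growthExp hD hd N)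
        _ ≤ η N * (p (N + 1) + growthExp D d (N + 1)) := by
            have := hη0 N
            gcongr
        _ = _ := by field_simp
    · simpa using hη.tendsto_atTop_zero.mul (hpL.add_const 1)
  refine ⟨L - 1, (tendsto_add_atTop_iff_nat 1).1 ?_⟩
  have := hpL.sub herr
  rw [sub_zero] at this
  refine this.congr fun N => ?_
  rw [hp]
  ring

lemma weightSum_div_le_of_lt (hD : 1 ≤ D) (hd : ∀ n, 1 ≤ n → 1 ≤ d n)
    (ha : a ∈ Set.Ioo (0 : ℝ) 1) (hc : 0 ≤ c) (hl0 : ∀ n, 1 ≤ n → 0 ≤ l n)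
    (hmono : MonotoneOn l (Set.Ici 1)) {s : ℕ} (hs : 1 ≤ s) (hls : l s < s) :
    weightSum D d (fun n => l n + l n ^ a + c) s / growthExp D d (s + 1) ≤
      2 * (2 * ((s : ℝ) ^ 2 / 2 ^ s) + (1 + c) * ((s : ℝ) ^ 1 / 2 ^ s)) := by
  obtain ⟨m, rfl⟩ : ∃ m, s = m + 1 := ⟨s - 1, by omega⟩
  set s : ℝ := ((m + 1 : ℕ) : ℝ)
  have h1 : ∑ n ∈ Finset.Icc 1 (m + 1), (l n + l n ^ a + c) ≤ s * (2 * s + 1 + c) := by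
    have : ∀ n ∈ Finset.Icc 1 (m + 1), l n + l n ^ a + c ≤ 2 * s + 1 + c := fun n hn => by
      rw [Finset.mem_Icc] at hn
      have h2 : l n ≤ s :=
        (hmono (Set.mem_Ici.2 hn.1) (Set.mem_Ici.2 (by omega)) hn.2).trans hls.le
      -- With ω = 1 and r = 0 this reads x^a ≤ x + 1.
      have h3 := rpow_le_pow_mul_add (ω := 1) ha le_rfl (hl0 n hn.1) 0
      simp only [pow_zero, one_mul] at h3
      linarith
    refine (Finset.sum_le_card_nsmul _ _ _ this).trans_eq ?_
    rw [Nat.card_Icc, nsmul_eq_mul, Nat.add_sub_cancel]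
  have hT := two_pow_mul_degProd_le_growthExp hD hd m
  have hE : (1 : ℝ) ≤ degProd d (m + 1) := by exact_mod_cast one_le_degProd hd (m + 1)
  have hD1 : (1 : ℝ) ≤ D := by exact_mod_cast hD
  have h0 : 0 < (2 : ℝ) ^ m * (D * degProd d (m + 1)) := by positivity
  calc _ ≤ D * degProd d (m + 1) * (s * (2 * s + 1 + c)) / ((2 : ℝ) ^ m * (D * degProd d (m + 1))) := by
        unfold weightSum
        gcongr
    _ = _ := by
        rw [pow_succ]
        field_simp
        ring

theorem exists_tendsto_div_growthExp (hD : 1 ≤ D) (hd : ∀ n, 1 ≤ n → 1 ≤ d n)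
    {ε : ℝ} (hε : 0 < ε) (ha : a ∈ Set.Ioo (0 : ℝ) 1) (hc : 0 ≤ c)
    (hl0 : ∀ n, 1 ≤ n → 0 ≤ l n) (hmono : MonotoneOn l (Set.Ici 1))
    (hgrowth : ∀ᶠ n : ℕ in atTop, (1 + ε) * Real.logb 2 n ≤ l n) {β : ℕ → ℝ}
    (hβ0 : ∀ n, 1 ≤ n → 0 ≤ β n) (hβ : ∀ n, 1 ≤ n → β n ≤ (2 : ℝ) ^ (l n ^ a - l n))
    (hlow : ∀ᶠ N : ℕ in atTop,
      (2 : ℝ) ^ (-weightSum D d (fun n => l n + l n ^ a + c) N) ≤ ∑' n, β (n + N + 1)) :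
    ∃ L : ℝ, Tendsto (fun n => l n / growthExp D d n) atTop (𝓝 L) := by
  obtain ⟨C, μ, hC, hμ, hdich⟩ := exists_tail_dichotomy hε ha hl0 hmono hgrowth hβ0 hβ hlow
  obtain ⟨δ, hδ, hδ0, hstep⟩ := exists_summable_step ha hc hC
  have hw0 := fun s hs hls => weightSum_div_le_of_lt (s := s) hD hd ha hc hl0 hmono hs hls
  set p : ℕ → ℝ := fun n => l n + l n ^ a + c with hp
  have hp0 : ∀ n, 1 ≤ n → 0 ≤ p n := fun n hn => by
    have := hl0 n hn
    simp only [hp]; positivity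
  have hg0 : ∀ N, 0 ≤ weightSum D d p N := weightSum_nonneg hp0
  have hT0 := growthExp_pos hD hd
  have hstep' : ∀ r, l (r + 1) - 2 * l (r + 1) ^ a ≤ weightSum D d p r + C →
      p (r + 1) ≤ (1 + δ r) * weightSum D d p r + δ r * growthExp D d (r + 1) := fun r hr =>
    hstep r _ _ _ (hl0 _ (by omega)) (hg0 r) (two_pow_le_growthExp hD hd r) hr
  by_cases hreg : ∀ᶠ n : ℕ in atTop, (n : ℝ) ≤ l n
  · refine exists_tendsto_div_growthExp_of_step hD hd ha hc hl0 hp hδ hδ0 ?_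
    obtain ⟨M, hM⟩ := eventually_atTop.1 hreg
    filter_upwards [hdich, eventually_ge_atTop M] with r hr hrM
    exact hstep' r (hr.1 fun n hn => hM n (by omega))
  by_contra hno
  -- A nonnegative ratio with no limit does not tend to 0.
  have hlam : ∃ lam : ℝ, 0 < lam ∧ ∃ᶠ n in atTop, lam ≤ l n / growthExp D d n := by
    by_contra! hcon
    refine hno ⟨0, tendsto_order.2 ⟨fun x hx => ?_, fun x hx => ?_⟩⟩
    · filter_upwards [eventually_ge_atTop 1] with n hn
      exact hx.trans_le (div_nonneg (hl0 n hn) (hT0 n).le)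
    · simpa using hcon x hx
  obtain ⟨lam, hlam, hfreq⟩ := hlam
  -- This makes μ l_k ≥ 2ξ T_k: one ξ T_k will dominate g_r, the other the constant C.
  set ξ := μ * lam / 2 with hξ
  have hξ0 : 0 < ξ := by positivity
  set w : ℕ → ℝ := fun s => 2 * (2 * ((s : ℝ) ^ 2 / 2 ^ s) + (1 + c) * ((s : ℝ) ^ 1 / 2 ^ s))
  have hw : Tendsto w atTop (𝓝 0) := by
    have h1 := tendsto_pow_const_div_const_pow_of_one_lt 2 (one_lt_two (α := ℝ))
    have h2 := tendsto_pow_const_div_const_pow_of_one_lt 1 (one_lt_two (α := ℝ))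
    simpa [w] using ((h1.const_mul 2).add (h2.const_mul (1 + c))).const_mul 2
  have hsmall : ∀ᶠ s in atTop, Real.exp (∑' i, δ (i + s)) * (1 + w s) ≤ 1 + ξ := by
    have h1 := (tendsto_sum_nat_add δ).rexp.mul (hw.const_add 1)
    rw [Real.exp_zero, one_mul, add_zero] at h1
    exact h1.eventually_le_const (by linarith)
  have hbig : ∀ᶠ s : ℕ in atTop, C < ξ * 2 ^ s :=
    ((tendsto_pow_atTop_atTop_of_one_lt (one_lt_two (α := ℝ))).const_mul_atTop hξ0).eventually_gt_atTop C
  obtain ⟨M, hM⟩ := eventually_atTop.1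
    (hdich.and (hsmall.and (hbig.and (eventually_ge_atTop 1))))
  rw [not_eventually] at hreg
  obtain ⟨s₁, hs₁, hls₁⟩ := frequently_atTop.1 hreg M
  obtain ⟨k, hk, hlk⟩ := frequently_atTop.1 hfreq (s₁ + 1)
  rw [not_le] at hls₁
  rw [le_div_iff₀ (hT0 k)] at hlk
  classical
  -- The last irregular index below k. Strictly between s and k one has l_n ≥ n, so the second
  -- clause of the dichotomy applies at every r in [s, k).
  set s := Nat.findGreatest (fun s : ℕ => l s < s) (k - 1)
  have hs₁s : s₁ ≤ s := Nat.le_findGreatest (by omega) hls₁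
  have hls : l s < s := Nat.findGreatest_spec (P := fun s : ℕ => l s < s) (by omega : s₁ ≤ k - 1) hls₁
  have hsk : s ≤ k - 1 := Nat.findGreatest_le _
  have hgt : ∀ n : ℕ, s < n → n < k → (n : ℝ) ≤ l n := fun n h1 h2 =>
    not_lt.1 (Nat.findGreatest_is_greatest (P := fun s : ℕ => l s < s) h1 (by omega))
  -- Adding 1 makes the affine recursion for q multiplicative.
  set Y : ℕ → ℝ := fun N => 1 + weightSum D d p N / growthExp D d (N + 1) with hY
  have hY1 : ∀ N, 0 ≤ Y N := fun N =>
    add_nonneg zero_le_one (div_nonneg (hg0 N) (hT0 _).le)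
  have hbound : ∀ r, s ≤ r → r < k → (∀ n, s ≤ n → n < r → Y (n + 1) ≤ (1 + δ n) * Y n) →
      weightSum D d p r ≤ ξ * growthExp D d k := fun r hsr hrk hr => by
    have h1 := le_exp_sum_mul hsr hY1 hr
    have h2 : ∑ i ∈ Finset.Ico s r, δ i ≤ ∑' i, δ (i + s) := by
      rw [Finset.sum_Ico_eq_sum_range]
      simp only [add_comm s]
      exact ((summable_nat_add_iff s).2 hδ).sum_le_tsum _ fun i _ => hδ0 _
    have h3 : Y r ≤ 1 + ξ := calc
      Y r ≤ _ := h1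
      _ ≤ Real.exp (∑' i, δ (i + s)) * (1 + w s) := by
          have := hw0 s (by have := (hM s (by omega)).2.2.2; omega) hls
          gcongr
          · exact hY1 s
          · exact add_le_add_right this 1
      _ ≤ 1 + ξ := (hM s (by omega)).2.1
    have h4 : weightSum D d p r / growthExp D d (r + 1) ≤ ξ := by
      simp only [hY] at h3; linarith
    rw [div_le_iff₀ (hT0 _)] at h4
    exact h4.trans (mul_le_mul_of_nonneg_left (growthExp_le hD hd (by omega) (by omega)) hξ0.le)
  have hClt : C < ξ * growthExp D d k := by
    have h1 := (hM (k - 1) (by omega)).2.2.1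
    have h2 := two_pow_le_growthExp hD hd (k - 1)
    rw [Nat.sub_add_cancel (by omega)] at h2
    exact h1.trans_le (mul_le_mul_of_nonneg_left h2 hξ0.le)
  have hlk' : 2 * (ξ * growthExp D d k) ≤ μ * l k := by
    have := mul_le_mul_of_nonneg_left hlk hμ.le
    rw [hξ]; linarith
  -- Bootstrap: steps up to n keep g_n ≤ ξ T_k, which rules out μ l_k ≤ g_n + C, so the dichotomy
  -- yields the step at n.
  have hsteps : ∀ r, s ≤ r → r < k → ∀ n, s ≤ n → n < r → Y (n + 1) ≤ (1 + δ n) * Y n := by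
    intro r hsr
    induction r, hsr using Nat.le_induction with
    | base => intro _ n h1 h2; omega
    | succ r hsr ih =>
      intro hrk n h1 h2
      rcases Nat.lt_succ_iff_lt_or_eq.1 h2 with h3 | rfl
      · exact ih (by omega) n h1 h3
      have hb := hbound n hsr (by omega) (ih (by omega))
      have hd2 := (hM n (by omega)).1.2.1 k (by omega) fun m hm1 hm2 => hgt m (by omega) hm2
      rcases hd2 with hd2 | hd2
      · have := weightSum_div_step hD hd (hδ0 n) (hg0 n) (hstep' n hd2)
        simp only [hY]
        linarith
      · linarith
  have hfin := hbound (k - 1) hsk (by omega) (hsteps (k - 1) hsk (by omega))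
  -- The unconditional clause at k - 1 gives μ l_k ≤ g_{k-1} + C < 2ξ T_k, a contradiction.
  have hd3 := (hM (k - 1) (by omega)).1.2.2
  rw [Nat.sub_add_cancel (by omega)] at hd3
  linarith

end

/-! ### Houses and norms of algebraic integers -/

lemma norm_le_algHouse {x z : ℂ} (hx : IsAlgebraic ℚ x)
    (hz : Polynomial.aeval z (minpoly ℚ x) = 0) : ‖z‖ ≤ algHouse x :=
  le_csSup (((minpoly ℚ x).rootSet_finite ℂ).image _).bddAbove
    ⟨z, (Polynomial.mem_rootSet.2 ⟨minpoly.ne_zero hx.isIntegral, hz⟩), rfl⟩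

lemma norm_le_algHouse_self {x : ℂ} (hx : IsAlgebraic ℚ x) : ‖x‖ ≤ algHouse x :=
  norm_le_algHouse hx (minpoly.aeval ℚ x)

lemma norm_algHom_le_algHouse {F : IntermediateField ℚ ℂ} (σ : F →ₐ[ℚ] ℂ) (x : F)
    (hx : IsAlgebraic ℚ (x : ℂ)) : ‖σ x‖ ≤ algHouse x := by
  refine norm_le_algHouse hx ?_
  rw [Polynomial.aeval_algHom_apply, show minpoly ℚ (x : ℂ) = minpoly ℚ x from minpoly.algebraMap_eq
    (algebraMap F ℂ).injective x, minpoly.aeval, map_zero]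

/-- The norm is a nonzero rational integer and the product of all embeddings; the inclusion is
singled out and the others are bounded by B. -/
lemma one_le_norm_mul_pow {F : IntermediateField ℚ ℂ} [FiniteDimensional ℚ F] {ξ : F}
    (hint : IsIntegral ℤ (ξ : ℂ)) (hne : ξ ≠ 0) {B : ℝ}
    (hσ : ∀ σ : F →ₐ[ℚ] ℂ, ‖σ ξ‖ ≤ B) :
    1 ≤ ‖(ξ : ℂ)‖ * B ^ (Module.finrank ℚ F - 1) := by
  have hint' : IsIntegral ℤ ξ := by
    rwa [← isIntegral_algebraMap_iff (algebraMap F ℂ).injective (R := ℤ)]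
  obtain ⟨m, hm⟩ := IsIntegrallyClosed.isIntegral_iff.1 (Algebra.isIntegral_norm ℚ hint')
  have hm0 : m ≠ 0 := by
    rintro rfl
    rw [map_zero] at hm
    exact hne (Algebra.norm_eq_zero_iff.1 hm.symm)
  have h1 : (1 : ℝ) ≤ ‖algebraMap ℚ ℂ (Algebra.norm ℚ ξ)‖ := by
    rw [← hm]
    simp only [eq_intCast, map_intCast, Complex.norm_intCast]
    exact_mod_cast Int.one_le_abs hm0
  rw [Algebra.norm_eq_prod_embeddings ℚ ℂ ξ, norm_prod] at h1
  classical
  refine (h1.trans_eq (Finset.mul_prod_erase _ _ (Finset.mem_univ F.val)).symm).trans (mul_le_mul_of_nonneg_left ?_ (norm_nonneg _))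
  calc _ ≤ ∏ _σ ∈ Finset.univ.erase F.val, B :=
        Finset.prod_le_prod (fun _ _ => norm_nonneg _) fun σ _ => hσ σ
    _ = _ := by
        rw [Finset.prod_const, Finset.card_erase_of_mem (Finset.mem_univ _), Finset.card_univ,
          AlgHom.card]

/-! ### The tower of fields -/

section
variable {α : ℕ → ℂ}

/-- The field obtained from the `n`-th field of the tower by adjoining `x`. -/
noncomputable def towerAdjoin (α : ℕ → ℂ) (n : ℕ) (x : ℂ) : IntermediateField ℚ ℂ :=
  (IntermediateField.adjoin (towerField α n) {x}).restrictScalars ℚ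

lemma le_towerAdjoin (α : ℕ → ℂ) (n : ℕ) (x : ℂ) : towerField α n ≤ towerAdjoin α n x :=
  fun z hz => by
    rw [towerAdjoin, IntermediateField.mem_restrictScalars]
    exact (IntermediateField.adjoin (towerField α n) {x}).algebraMap_mem ⟨z, hz⟩

lemma mem_towerAdjoin (α : ℕ → ℂ) (n : ℕ) (x : ℂ) : x ∈ towerAdjoin α n x := by
  rw [towerAdjoin, IntermediateField.mem_restrictScalars]
  exact IntermediateField.mem_adjoin_simple_self _ _

lemma towerField_mono (α : ℕ → ℂ) : Monotone (towerField α) :=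
  monotone_nat_of_le_succ fun n => le_towerAdjoin α n (α (n + 1))

lemma mem_towerField {m n : ℕ} (hm : 1 ≤ m) (hmn : m ≤ n) : α m ∈ towerField α n := by
  refine towerField_mono α hmn ?_
  obtain ⟨k, rfl⟩ : ∃ k, m = k + 1 := ⟨m - 1, by omega⟩
  exact mem_towerAdjoin α k (α (k + 1))

lemma exists_mem_towerField {x : ℂ} (hx : x ∈ unionField α) : ∃ n, x ∈ towerField α n := by
  have hle : unionField α ≤ ⨆ n, towerField α n := by
    refine IntermediateField.adjoin_le_iff.2 ?_
    rintro _ ⟨n, hn, rfl⟩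
    exact le_iSup (towerField α) n (mem_towerField hn le_rfl)
  have h := hle hx
  rw [← SetLike.mem_coe,
    IntermediateField.coe_iSup_of_directed (towerField_mono α).directed_le] at h
  exact Set.mem_iUnion.1 h

lemma finrank_towerAdjoin {x : ℂ} (hx : IsIntegral ℚ x) (n : ℕ) :
    Module.finrank ℚ (towerAdjoin α n x) =
      Module.finrank ℚ (towerField α n) * (minpoly (towerField α n) x).natDegree := by
  rw [← IntermediateField.adjoin.finrank (K := towerField α n) hx.tower_top]
  exact (Module.finrank_mul_finrank ℚ (towerField α n)
    (IntermediateField.adjoin (towerField α n) {x})).symm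

lemma finiteDimensional_towerAdjoin {x : ℂ} (hx : IsIntegral ℚ x) (n : ℕ)
    [FiniteDimensional ℚ (towerField α n)] : FiniteDimensional ℚ (towerAdjoin α n x) := by
  have := IntermediateField.adjoin.finiteDimensional (K := towerField α n) (hx.tower_top)
  exact FiniteDimensional.trans ℚ (towerField α n) (IntermediateField.adjoin (towerField α n) {x})

lemma finiteDimensional_towerField (hα : ∀ n, 1 ≤ n → IsIntegral ℚ (α n)) (n : ℕ) :
    FiniteDimensional ℚ (towerField α n) := by
  induction n with
  | zero => exact inferInstanceAs (FiniteDimensional ℚ (⊥ : IntermediateField ℚ ℂ))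
  | succ n ih => exact finiteDimensional_towerAdjoin (hα (n + 1) (by omega)) n

lemma finrank_towerField (hα : ∀ n, 1 ≤ n → IsIntegral ℚ (α n)) (n : ℕ) :
    Module.finrank ℚ (towerField α n) = totalDeg α n := by
  induction n with
  | zero =>
    change Module.finrank ℚ (⊥ : IntermediateField ℚ ℂ) = _
    rw [IntermediateField.finrank_bot]
    simp [totalDeg]
  | succ n ih =>
    have := finrank_towerAdjoin (α := α) (hα (n + 1) (by omega)) n
    rw [ih] at this
    rw [totalDeg, Finset.prod_Icc_succ_top (by omega)]
    exact this

lemma one_le_relDeg (hα : ∀ n, 1 ≤ n → IsIntegral ℚ (α n)) (n : ℕ) (hn : 1 ≤ n) :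
    1 ≤ relDeg α n :=
  minpoly.natDegree_pos (hα n hn).tower_top

/-- The minimal polynomial over the union has finitely many coefficients, so it is already defined
over some stage of the tower. -/
lemma eventually_natDegree_minpoly_le {x : ℂ} {D : ℕ} (hx : IsAlgebraic (unionField α) x)
    (hD : (minpoly (unionField α) x).natDegree ≤ D) :
    ∀ᶠ n in atTop, (minpoly (towerField α n) x).natDegree ≤ D := by
  set f := minpoly (unionField α) x with hf
  have hf1 : f.Monic := minpoly.monic hx.isIntegral
  choose N hN using fun i => exists_mem_towerField (f.coeff i).2
  filter_upwards [eventually_ge_atTop (f.support.sup N)] with n hn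
  have hlift : f.map (algebraMap (unionField α) ℂ) ∈
      Polynomial.lifts (algebraMap (towerField α n) ℂ) := by
    rw [Polynomial.lifts_iff_coeff_lifts]
    intro i
    rw [Polynomial.coeff_map]
    by_cases hi : f.coeff i = 0
    · exact ⟨0, by simp [hi]⟩
    · exact ⟨⟨f.coeff i, towerField_mono α
        ((Finset.le_sup (Polynomial.mem_support_iff.2 hi)).trans hn) (hN i)⟩, rfl⟩
  obtain ⟨q, hq, hqd, hqm⟩ := Polynomial.lifts_and_natDegree_eq_and_monic hlift (hf1.map _)
  have hroot : Polynomial.aeval x q = 0 := by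
    rw [Polynomial.aeval_def, ← Polynomial.eval_map, hq, Polynomial.eval_map,
      ← Polynomial.aeval_def, hf, minpoly.aeval]
  calc _ ≤ q.natDegree := Polynomial.natDegree_le_natDegree (minpoly.min _ _ hqm hroot)
    _ = f.natDegree := by rw [hqd, hf1.natDegree_map]
    _ ≤ D := hD

lemma isAlgebraic_of_isAlgebraic_unionField (hα : ∀ n, 1 ≤ n → IsIntegral ℚ (α n)) {x : ℂ}
    (hx : IsAlgebraic (unionField α) x) : IsAlgebraic ℚ x := by
  have : Algebra.IsAlgebraic ℚ (unionField α) := by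
    refine IntermediateField.isAlgebraic_adjoin ?_
    rintro _ ⟨n, hn, rfl⟩
    exact hα n hn
  exact hx.restrictScalars ℚ

end

/-! ### A Liouville inequality for the partial products -/

section
variable {b : ℕ → ℕ}

lemma norm_algHom_sub_prod_le {F : IntermediateField ℚ ℂ} {s : Finset ℕ} {A : ℕ → F} {X : F}
    {h : ℕ → ℝ} {H : ℝ} (hb : ∀ n ∈ s, 0 < b n) (hh : ∀ n ∈ s, 1 ≤ h n) (y : ℤ)
    (σ : F →ₐ[ℚ] ℂ) (hA : ∀ n ∈ s, ‖σ (A n)‖ ≤ h n) (hX : ‖σ X‖ ≤ H) :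
    ‖σ (y * (X * ∏ n ∈ s, A n - ∏ n ∈ s, (A n + b n)))‖ ≤
      ‖(y : ℂ)‖ * (H + 1) * ∏ n ∈ s, (2 * (h n * b n)) := by
  have hHb : ∀ n ∈ s, h n + b n ≤ 2 * (h n * b n) ∧ (1 : ℝ) ≤ b n := fun n hn => by
    have h4 : (1 : ℝ) ≤ b n := by exact_mod_cast hb n hn
    exact ⟨by nlinarith [hh n hn, mul_nonneg (sub_nonneg.2 (hh n hn)) (sub_nonneg.2 h4)], h4⟩
  have h1 : ‖∏ n ∈ s, σ (A n)‖ ≤ ∏ n ∈ s, (2 * (h n * b n)) := by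
    rw [norm_prod]
    refine Finset.prod_le_prod (fun _ _ => norm_nonneg _) fun n hn => ?_
    obtain ⟨h3, h4⟩ := hHb n hn
    linarith [hA n hn]
  have h2 : ‖∏ n ∈ s, (σ (A n) + b n)‖ ≤ ∏ n ∈ s, (2 * (h n * b n)) := by
    rw [norm_prod]
    refine Finset.prod_le_prod (fun _ _ => norm_nonneg _) fun n hn => ?_
    obtain ⟨h3, h4⟩ := hHb n hn
    refine (norm_add_le _ _).trans ?_
    rw [Complex.norm_natCast]
    linarith [hA n hn]
  simp only [map_mul, map_sub, map_prod, map_add, map_natCast, map_intCast]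
  generalize ∏ n ∈ s, (2 * (h n * b n)) = Q at h1 h2 ⊢
  have h3 : ‖σ X * ∏ n ∈ s, σ (A n)‖ ≤ H * Q := by
    rw [norm_mul]
    exact mul_le_mul hX h1 (norm_nonneg _) ((norm_nonneg _).trans hX)
  rw [norm_mul, mul_assoc]
  refine mul_le_mul_of_nonneg_left ?_ (norm_nonneg _)
  calc _ ≤ H * Q + Q := (norm_sub_le _ _).trans (add_le_add h3 h2)
    _ = _ := by ring

/-- Multiplying X - P by y∏A_n gives an algebraic integer ξ. The common bound B for its conjugates
also satisfies |ξ| ≤ B·|X - P|, which raises the exponent from [F:ℚ] - 1 to [F:ℚ]. -/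
lemma one_le_norm_sub_mul_pow_finrank {F : IntermediateField ℚ ℂ} [FiniteDimensional ℚ F]
    {s : Finset ℕ} {A : ℕ → F} {X : F} {h : ℕ → ℝ} {H : ℝ}
    (hint : ∀ n ∈ s, IsIntegral ℤ (A n : ℂ)) (hA0 : ∀ n ∈ s, A n ≠ 0)
    (hb : ∀ n ∈ s, 0 < b n) (hh : ∀ n ∈ s, 1 ≤ h n) {y : ℤ} (hy0 : y ≠ 0)
    (hy : IsIntegral ℤ (y • (X : ℂ)))
    (hA : ∀ σ : F →ₐ[ℚ] ℂ, ∀ n ∈ s, ‖σ (A n)‖ ≤ h n) (hX : ∀ σ : F →ₐ[ℚ] ℂ, ‖σ X‖ ≤ H)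
    (hne : (X : ℂ) ≠ ∏ n ∈ s, (1 + (b n : ℂ) / A n)) :
    1 ≤ ‖(X : ℂ) - ∏ n ∈ s, (1 + (b n : ℂ) / A n)‖ *
      (‖(y : ℂ)‖ * (H + 1) * ∏ n ∈ s, (2 * (h n * b n))) ^ Module.finrank ℚ F := by
  have hσ := fun σ : F →ₐ[ℚ] ℂ => norm_algHom_sub_prod_le hb hh y σ (hA σ) (hX σ)
  have hH : 0 ≤ H := (norm_nonneg _).trans (hX F.val)
  have hQ : ‖∏ n ∈ s, (A n : ℂ)‖ ≤ ∏ n ∈ s, (2 * (h n * b n)) := by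
    rw [norm_prod]
    refine Finset.prod_le_prod (fun _ _ => norm_nonneg _) fun n hn => ?_
    have h3 := hh n hn
    have h4 : (1 : ℝ) ≤ b n := by exact_mod_cast hb n hn
    have h5 : ‖(A n : ℂ)‖ ≤ h n := hA F.val n hn
    nlinarith
  generalize ∏ n ∈ s, (2 * (h n * b n)) = Q at hσ hQ ⊢
  set P := ∏ n ∈ s, (1 + (b n : ℂ) / A n)
  set ξ : F := y * (X * ∏ n ∈ s, A n - ∏ n ∈ s, (A n + b n)) with hξ
  have hα0 : ∀ n ∈ s, (A n : ℂ) ≠ 0 := fun n hn => by simpa using hA0 n hn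
  have hPA : P * ∏ n ∈ s, (A n : ℂ) = ∏ n ∈ s, ((A n : ℂ) + b n) := by
    rw [← Finset.prod_mul_distrib]
    refine Finset.prod_congr rfl fun n hn => ?_
    have := hα0 n hn
    field_simp
  have hξ0 : (ξ : ℂ) = y * (X * ∏ n ∈ s, (A n : ℂ) - ∏ n ∈ s, ((A n : ℂ) + b n)) := by
    rw [hξ]
    push_cast
    rfl
  have hξP : (ξ : ℂ) = y * (∏ n ∈ s, (A n : ℂ)) * (X - P) := by
    rw [hξ0, ← hPA]; ring
  have hξne : ξ ≠ 0 := fun h0 => by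
    have h1 : (∏ n ∈ s, (A n : ℂ)) ≠ 0 := Finset.prod_ne_zero_iff.2 hα0
    have h2 : (y : ℂ) ≠ 0 := by exact_mod_cast hy0
    refine mul_ne_zero (mul_ne_zero h2 h1) (sub_ne_zero.2 hne) ?_
    rw [← hξP, h0]
    rfl
  have hξint : IsIntegral ℤ (ξ : ℂ) := by
    have h1 : IsIntegral ℤ (∏ n ∈ s, (A n : ℂ)) := IsIntegral.prod _ hint
    have h2 : IsIntegral ℤ (∏ n ∈ s, ((A n : ℂ) + b n)) :=
      IsIntegral.prod _ fun n hn => (hint n hn).add (by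
        simpa using (isIntegral_algebraMap (R := ℤ) (A := ℂ) (x := (b n : ℤ))))
    have h3 : IsIntegral ℤ (y : ℂ) := by
      simpa using (isIntegral_algebraMap (R := ℤ) (A := ℂ) (x := y))
    have e1 : (ξ : ℂ) = (y • (X : ℂ)) * ∏ n ∈ s, (A n : ℂ)
        - y * ∏ n ∈ s, ((A n : ℂ) + b n) := by
      rw [hξ0, zsmul_eq_mul]; ring
    rw [e1]
    exact (hy.mul h1).sub (h3.mul h2)
  have hmain := one_le_norm_mul_pow hξint hξne hσ
  have hQ0 : 0 ≤ Q := (norm_nonneg _).trans hQ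
  have hξle : ‖(ξ : ℂ)‖ ≤ ‖(y : ℂ)‖ * (H + 1) * Q * ‖(X : ℂ) - P‖ := by
    rw [hξP, norm_mul, norm_mul]
    refine mul_le_mul_of_nonneg_right ?_ (norm_nonneg _)
    refine mul_le_mul (le_mul_of_one_le_right (norm_nonneg _) (by linarith)) hQ (norm_nonneg _) ?_
    exact mul_nonneg (norm_nonneg _) (by linarith)
  have hB0 : 0 ≤ ‖(y : ℂ)‖ * (H + 1) * Q :=
    mul_nonneg (mul_nonneg (norm_nonneg _) (by linarith)) hQ0
  generalize ‖(y : ℂ)‖ * (H + 1) * Q = B at hmain hξle hB0 ⊢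
  have hfpos : 0 < Module.finrank ℚ F := Module.finrank_pos
  calc (1 : ℝ) ≤ _ := hmain
    _ ≤ B * ‖(X : ℂ) - P‖ * B ^ (Module.finrank ℚ F - 1) :=
        mul_le_mul_of_nonneg_right hξle (pow_nonneg hB0 _)
    _ = ‖(X : ℂ) - P‖ * B ^ (Module.finrank ℚ F - 1 + 1) := by ring
    _ = _ := by rw [Nat.sub_add_cancel hfpos]

lemma exists_inv_pow_le_norm_sub {α : ℕ → ℂ} (hα : ∀ n, 1 ≤ n → IsIntegral ℤ (α n))
    (hone : ∀ n, 1 ≤ n → 1 ≤ ‖α n‖) (hb : ∀ n, 1 ≤ n → 0 < b n) {x : ℂ} (hx : IsAlgebraic ℚ x) :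
    ∃ C : ℝ, 1 ≤ C ∧ ∀ N D : ℕ, (minpoly (towerField α N) x).natDegree ≤ D →
      x ≠ ∏ n ∈ Finset.Icc 1 N, (1 + (b n : ℂ) / α n) →
      ((C * ∏ n ∈ Finset.Icc 1 N, (2 * (algHouse (α n) * b n))) ^ (D * totalDeg α N))⁻¹ ≤
        ‖x - ∏ n ∈ Finset.Icc 1 N, (1 + (b n : ℂ) / α n)‖ := by
  have hαℚ : ∀ n, 1 ≤ n → IsIntegral ℚ (α n) := fun n hn => (hα n hn).tower_top
  have hH : ∀ n, 1 ≤ n → 1 ≤ algHouse (α n) := fun n hn =>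
    (hone n hn).trans (norm_le_algHouse_self (hαℚ n hn).isAlgebraic)
  obtain ⟨y, hy0, hy⟩ := ((IsFractionRing.isAlgebraic_iff ℤ ℚ ℂ).2 hx).exists_integral_multiple
  have hy1 : 1 ≤ ‖(y : ℂ)‖ := by
    rw [Complex.norm_intCast]; exact_mod_cast Int.one_le_abs hy0
  have hx1 : 1 ≤ algHouse x + 1 := by
    linarith [(norm_nonneg _).trans (norm_le_algHouse_self hx)]
  have hC : 1 ≤ ‖(y : ℂ)‖ * (algHouse x + 1) := one_le_mul_of_one_le_of_one_le hy1 hx1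
  refine ⟨‖(y : ℂ)‖ * (algHouse x + 1), hC, ?_⟩
  intro N D hdeg hne
  have hB : 1 ≤ ‖(y : ℂ)‖ * (algHouse x + 1) *
      ∏ n ∈ Finset.Icc 1 N, (2 * (algHouse (α n) * b n)) := by
    refine one_le_mul_of_one_le_of_one_le hC (Finset.one_le_prod fun n hn => ?_)
    have h1 := (Finset.mem_Icc.1 hn).1
    have h4 : (1 : ℝ) ≤ b n := by exact_mod_cast hb n h1
    linarith [one_le_mul_of_one_le_of_one_le (hH n h1) h4]
  have := finiteDimensional_towerField hαℚ N
  have := finiteDimensional_towerAdjoin (α := α) hx.isIntegral N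
  have hrank := finrank_towerAdjoin (α := α) hx.isIntegral N
  rw [finrank_towerField hαℚ] at hrank
  have hxF : x ∈ towerAdjoin α N x := mem_towerAdjoin α N x
  have hαF : ∀ n ∈ Finset.Icc 1 N, α n ∈ towerAdjoin α N x := fun n hn =>
    le_towerAdjoin α N x (mem_towerField (Finset.mem_Icc.1 hn).1 (Finset.mem_Icc.1 hn).2)
  generalize towerAdjoin α N x = F at *
  have hαF' : ∀ n ∈ Finset.Icc 1 N, ∃ z : F, (z : ℂ) = α n := fun n hn =>
    ⟨⟨α n, hαF n hn⟩, rfl⟩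
  choose! A hA using hαF'
  have hP : ∏ n ∈ Finset.Icc 1 N, (1 + (b n : ℂ) / A n) =
      ∏ n ∈ Finset.Icc 1 N, (1 + (b n : ℂ) / α n) :=
    Finset.prod_congr rfl fun n hn => by rw [hA n hn]
  have key := one_le_norm_sub_mul_pow_finrank (F := F) (s := Finset.Icc 1 N) (A := A)
    (X := ⟨x, hxF⟩) (b := b) (h := fun n => algHouse (α n)) (H := algHouse x)
    (fun n hn => by rw [hA n hn]; exact hα n (Finset.mem_Icc.1 hn).1)
    (fun n hn h0 => by
      have h1 := hone n (Finset.mem_Icc.1 hn).1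
      rw [← hA n hn, h0] at h1
      norm_num at h1)
    (fun n hn => hb n (Finset.mem_Icc.1 hn).1) (fun n hn => hH n (Finset.mem_Icc.1 hn).1) hy0 hy
    (fun σ n hn => by
      have := norm_algHom_le_algHouse σ (A n)
        (by rw [hA n hn]; exact (hαℚ n (Finset.mem_Icc.1 hn).1).isAlgebraic)
      rwa [hA n hn] at this)
    (fun σ => norm_algHom_le_algHouse σ _ hx) (by rw [hP]; exact hne)
  rw [hP] at key
  have hle : Module.finrank ℚ F ≤ D * totalDeg α N := by
    rw [hrank, mul_comm]
    exact Nat.mul_le_mul_right _ hdeg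
  rw [inv_le_iff_one_le_mul₀ (pow_pos (by linarith) _)]
  exact key.trans (mul_le_mul_of_nonneg_left (pow_le_pow_right₀ hB hle) (norm_nonneg _))

end

/-! ### Infinite products -/

lemma norm_tprod_one_add_sub_one_le {f : ℕ → ℂ} (hf : Summable fun n => ‖f n‖) :
    ‖∏' n, (1 + f n) - 1‖ ≤ Real.exp (∑' n, ‖f n‖) - 1 := by
  have h1 := (multipliable_one_add_of_summable hf).hasProd.tendsto_prod_nat
  refine le_of_tendsto' (h1.sub_const 1).norm fun n => ?_
  refine (Finset.norm_prod_one_add_sub_one_le _ _).trans ?_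
  gcongr
  exact hf.sum_le_tsum _ fun _ _ => norm_nonneg _

/-- Factor out the partial product, bounded by exp(Σ‖f n‖); the remaining factor differs from 1 by
at most exp(t) - 1 ≤ 2t once the tail sum t is at most 1. -/
lemma norm_tprod_sub_prod_le {f : ℕ → ℂ} (hf : Summable fun n => ‖f n‖) :
    ∃ A : ℝ, 1 ≤ A ∧ ∀ᶠ N in atTop,
      ‖∏' n, (1 + f n) - ∏ n ∈ Finset.range N, (1 + f n)‖ ≤ A * ∑' n, ‖f (n + N)‖ := by
  refine ⟨2 * Real.exp (∑' n, ‖f n‖), ?_, ?_⟩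
  · have h0 : 0 ≤ ∑' n, ‖f n‖ := tsum_nonneg fun n => norm_nonneg (f n)
    linarith [Real.one_le_exp h0]
  filter_upwards [(tendsto_sum_nat_add fun n => ‖f n‖).eventually_le_const one_pos] with N hN
  have hfN : Summable fun n => ‖f (n + N)‖ := (summable_nat_add_iff N).2 hf
  have h0 : 0 ≤ ∑' n, ‖f (n + N)‖ := tsum_nonneg fun n => norm_nonneg _
  have h1 := (multipliable_one_add_of_summable hfN).prod_mul_tprod_nat_mul'
    (f := fun n => 1 + f n)
  have h2 := norm_tprod_one_add_sub_one_le hfN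
  have h3 : Real.exp (∑' n, ‖f (n + N)‖) - 1 ≤ 2 * ∑' n, ‖f (n + N)‖ := by
    have := Real.abs_exp_sub_one_le (x := ∑' n, ‖f (n + N)‖) (by rwa [abs_of_nonneg h0])
    rw [abs_of_nonneg h0] at this
    exact (le_abs_self _).trans this
  have h4 : ‖∏ n ∈ Finset.range N, (1 + f n)‖ ≤ Real.exp (∑' n, ‖f n‖) := by
    rw [norm_prod]
    calc _ ≤ ∏ n ∈ Finset.range N, Real.exp ‖f n‖ := by
          refine Finset.prod_le_prod (fun _ _ => norm_nonneg _) fun n _ => ?_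
          refine (norm_add_le _ _).trans ?_
          rw [norm_one, add_comm]
          exact Real.add_one_le_exp _
      _ = Real.exp (∑ n ∈ Finset.range N, ‖f n‖) := (Real.exp_sum _ _).symm
      _ ≤ _ := by
        gcongr
        exact hf.sum_le_tsum _ fun _ _ => norm_nonneg _
  rw [← h1, show ∀ p t : ℂ, p * t - p = p * (t - 1) from fun p t => by ring, norm_mul]
  calc _ ≤ Real.exp (∑' n, ‖f n‖) * (2 * ∑' n, ‖f (n + N)‖) := by
        gcongr
        exact h2.trans h3
    _ = _ := by ring

/-- The quantity e·log of the partial moduli is nondecreasing and rises infinitely often, so its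
limit exceeds every term. -/
lemma ne_prod_of_tendsto_prod {x : ℕ → ℂ} {P : ℂ} {e : ℝ}
    (hx0 : ∀ n, x n ≠ 0) (hx : ∀ n, 0 ≤ e * Real.log ‖x n‖)
    (hfreq : ∃ᶠ n in atTop, 0 < e * Real.log ‖x n‖)
    (hP : Tendsto (fun N => ∏ n ∈ Finset.range N, x n) atTop (𝓝 P)) (N : ℕ) :
    P ≠ ∏ n ∈ Finset.range N, x n := by
  intro h
  have hne : ∀ N, ∏ n ∈ Finset.range N, x n ≠ 0 := fun N =>
    Finset.prod_ne_zero_iff.2 fun n _ => hx0 n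
  set s : ℕ → ℝ := fun N => e * Real.log ‖∏ n ∈ Finset.range N, x n‖ with hs
  have hsucc : ∀ N, s (N + 1) = s N + e * Real.log ‖x N‖ := fun N => by
    simp only [hs]
    rw [Finset.prod_range_succ, norm_mul,
      Real.log_mul (norm_ne_zero_iff.2 (hne N)) (norm_ne_zero_iff.2 (hx0 N)), mul_add]
  have hmono : Monotone s := monotone_nat_of_le_succ fun n => by
    rw [hsucc]; linarith [hx n]
  have hlim : Tendsto s atTop (𝓝 (s N)) := by
    have hPN : ‖P‖ ≠ 0 := by rw [h]; exact norm_ne_zero_iff.2 (hne N)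
    have := (hP.norm.log hPN).const_mul e
    rwa [h] at this
  obtain ⟨n, hn, hpos⟩ := frequently_atTop.1 hfreq N
  have h1 := hmono hn
  have h2 := hmono.ge_of_tendsto hlim (n + 1)
  rw [hsucc] at h2
  linarith

/-- Explains the 1/2 in the sign condition: it decides on which side of 1 the modulus of a factor
lies. -/
lemma norm_one_add_div_sq_sub_one {z : ℂ} (hz : z ≠ 0) {r : ℝ} (hr : r ≠ 0) :
    ‖1 + r / z‖ ^ 2 - 1 = 2 * (r / ‖z‖) ^ 2 * ((z / r).re + 1 / 2) := by
  have hrz : (1 + r / z : ℂ) = (z + r) / z := by field_simp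
  have hn : ‖z‖ ≠ 0 := norm_ne_zero_iff.2 hz
  have h1 : ‖z + r‖ ^ 2 = ‖z‖ ^ 2 + 2 * r * z.re + r ^ 2 := by
    rw [Complex.sq_norm, Complex.sq_norm, Complex.normSq_apply, Complex.normSq_apply]
    simp
    ring
  rw [hrz, norm_div, div_pow, h1, Complex.div_ofReal_re]
  field_simp
  ring

lemma mul_log_nonneg_of_sq {e x : ℝ} (he : e = -1 ∨ e = 1) (hx : 0 < x)
    (h : 0 ≤ (x ^ 2 - 1) * e) : 0 ≤ e * Real.log x := by
  rcases he with rfl | rfl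
  · have := Real.log_nonpos hx.le (by nlinarith : x ≤ 1); linarith
  · have := Real.log_nonneg (by nlinarith : 1 ≤ x); linarith

lemma mul_log_pos_of_sq {e x : ℝ} (he : e = -1 ∨ e = 1) (hx : 0 < x)
    (h : 0 < (x ^ 2 - 1) * e) : 0 < e * Real.log x := by
  rcases he with rfl | rfl
  · have := Real.log_neg hx (by nlinarith : x < 1); linarith
  · have := Real.log_pos (by nlinarith : 1 < x); linarith

/-! ### Logarithmic form of the hypotheses -/

section
variable {α : ℕ → ℂ} {b : ℕ → ℕ} {ε a : ℝ}

lemma div_norm_le_two_rpow {z : ℂ} {m : ℕ} (hz : IsIntegral ℤ z) (hone : 1 ≤ ‖z‖)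
    (h : algHouse z * m ≤ ‖z‖ * (2 : ℝ) ^ (Real.logb 2 ‖z‖ ^ a)) :
    (m : ℝ) / ‖z‖ ≤ 2 ^ (Real.logb 2 ‖z‖ ^ a - Real.logb 2 ‖z‖) := by
  have hpos : 0 < ‖z‖ := by linarith
  have hle : ‖z‖ ≤ algHouse z := norm_le_algHouse_self hz.tower_top.isAlgebraic
  rw [Real.rpow_sub two_pos, Real.rpow_logb two_pos (by norm_num) hpos]
  refine div_le_div_of_nonneg_right ?_ hpos.le
  exact le_of_mul_le_mul_left ((mul_le_mul_of_nonneg_right hle (by positivity)).trans h) hpos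

lemma eventually_mul_logb_le
    (hgrowth : ∀ᶠ n : ℕ in atTop, (n : ℝ) ^ (1 + ε) < ‖α n‖) :
    ∀ᶠ n : ℕ in atTop, (1 + ε) * Real.logb 2 n ≤ Real.logb 2 ‖α n‖ := by
  filter_upwards [hgrowth, eventually_ge_atTop 1] with n hn hn1
  have hn0 : (0 : ℝ) < n := by exact_mod_cast hn1
  rw [← Real.logb_rpow_eq_mul_logb_of_pos hn0]
  exact Real.logb_le_logb_of_le one_lt_two (by positivity) hn.le

lemma summable_of_le_two_rpow {l β : ℕ → ℝ} (hε : 0 < ε) (ha : a ∈ Set.Ioo (0 : ℝ) 1)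
    (hl0 : ∀ n, 1 ≤ n → 0 ≤ l n) (hgrowth : ∀ᶠ n : ℕ in atTop, (1 + ε) * Real.logb 2 n ≤ l n)
    (hβ0 : ∀ n, 1 ≤ n → 0 ≤ β n) (hβ : ∀ n, 1 ≤ n → β n ≤ (2 : ℝ) ^ (l n ^ a - l n)) :
    Summable β := by
  obtain ⟨K, μ, -, h⟩ := exists_two_rpow_le_of_logb_le ha hε
  have hs : Summable fun n : ℕ => (2 : ℝ) ^ K * ((n : ℝ) ^ (1 + ε / 2))⁻¹ :=
    (Real.summable_nat_rpow_inv.2 (by linarith)).mul_left _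
  refine hs.of_norm_bounded_eventually_nat ?_
  filter_upwards [hgrowth, eventually_ge_atTop 1] with n hn hn1
  rw [Real.norm_of_nonneg (hβ0 n hn1)]
  simpa using (hβ n hn1).trans (h n 0 (l n) hn1 le_rfl (hl0 n hn1) hn)

/-- Both constants are absorbed into the summands: N ≥ 1 lets each factor carry a copy of A·C, and
D·m ≥ 1 lets A go under the power. -/
lemma mul_prod_pow_le_two_rpow {D N m : ℕ} (hN : 1 ≤ N) (hm : 1 ≤ D * m) {C : ℝ} (hC : 1 ≤ C)
    {A : ℝ} (hA : 1 ≤ A) {h t : ℕ → ℝ} (hh0 : ∀ n, 1 ≤ n → 0 ≤ h n)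
    (hh : ∀ n, 1 ≤ n → h n ≤ (2 : ℝ) ^ t n) :
    A * (C * ∏ n ∈ Finset.Icc 1 N, (2 * h n)) ^ (D * m) ≤
      2 ^ ((D : ℝ) * m * ∑ n ∈ Finset.Icc 1 N, (t n + Real.logb 2 (2 * (A * C)))) := by
  have hAC : 1 ≤ A * C := one_le_mul_of_one_le_of_one_le hA hC
  have hp0 : 0 ≤ ∏ n ∈ Finset.Icc 1 N, (2 * h n) :=
    Finset.prod_nonneg fun n hn => mul_nonneg two_pos.le (hh0 n (Finset.mem_Icc.1 hn).1)
  have h1 : A * C * ∏ n ∈ Finset.Icc 1 N, (2 * h n) ≤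
      2 ^ ∑ n ∈ Finset.Icc 1 N, (t n + Real.logb 2 (2 * (A * C))) := by
    calc _ ≤ (A * C) ^ N * ∏ n ∈ Finset.Icc 1 N, (2 * h n) :=
          mul_le_mul_of_nonneg_right (le_self_pow₀ hAC (by omega)) hp0
      _ = ∏ n ∈ Finset.Icc 1 N, (h n * (2 * (A * C))) := by
          simp only [Finset.prod_mul_distrib, Finset.prod_const, Nat.card_Icc, Nat.add_sub_cancel]
          ring
      _ ≤ ∏ n ∈ Finset.Icc 1 N, (2 : ℝ) ^ (t n + Real.logb 2 (2 * (A * C))) := by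
          refine Finset.prod_le_prod (fun n hn => ?_) fun n hn => ?_
          · exact mul_nonneg (hh0 n (Finset.mem_Icc.1 hn).1) (by linarith)
          · rw [Real.rpow_add two_pos, Real.rpow_logb two_pos (by norm_num) (by linarith)]
            exact mul_le_mul_of_nonneg_right (hh n (Finset.mem_Icc.1 hn).1) (by linarith)
      _ = _ := (Real.rpow_sum_of_pos two_pos _ _).symm
  calc _ ≤ A ^ (D * m) * (C * ∏ n ∈ Finset.Icc 1 N, (2 * h n)) ^ (D * m) := by
        refine mul_le_mul_of_nonneg_right (le_self_pow₀ hA (by omega)) (pow_nonneg ?_ _)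
        exact mul_nonneg (by linarith) hp0
    _ = (A * C * ∏ n ∈ Finset.Icc 1 N, (2 * h n)) ^ (D * m) := by rw [← mul_pow, mul_assoc]
    _ ≤ (2 ^ ∑ n ∈ Finset.Icc 1 N, (t n + Real.logb 2 (2 * (A * C)))) ^ (D * m) :=
        pow_le_pow_left₀ (mul_nonneg (by linarith) hp0) h1 _
    _ = _ := by
        rw [← Real.rpow_natCast, ← Real.rpow_mul two_pos.le]
        congr 1
        push_cast
        ring

lemma tendsto_rpow_one_div_of_tendsto_logb {x T : ℕ → ℝ} {L : ℝ} (hx : ∀ n, 1 ≤ n → 0 < x n)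
    (h : Tendsto (fun n => Real.logb 2 (x n) / T n) atTop (𝓝 L)) :
    Tendsto (fun n => x n ^ (1 / T n)) atTop (𝓝 ((2 : ℝ) ^ L)) := by
  have h1 : Tendsto (fun n => (2 : ℝ) ^ (Real.logb 2 (x n) / T n)) atTop (𝓝 ((2 : ℝ) ^ L)) :=
    tendsto_const_nhds.rpow h (Or.inl two_ne_zero)
  refine h1.congr' ?_
  filter_upwards [eventually_ge_atTop 1] with n hn
  rw [div_eq_mul_one_div, Real.rpow_mul two_pos.le, Real.rpow_logb two_pos (by norm_num) (hx n hn)]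

end

/-! ### The main theorem -/

theorem theorem1
    (D : ℕ) (hD : 1 ≤ D)
    (ε : ℝ) (hε : 0 < ε)
    (a : ℝ) (ha : a ∈ Set.Ioo (0 : ℝ) 1)
    (e : ℝ) (he : e = -1 ∨ e = 1)
    (b : ℕ → ℕ) (hb : ∀ n, 1 ≤ n → 0 < b n)
    (α : ℕ → ℂ) (hα : ∀ n, 1 ≤ n → IsIntegral ℤ (α n))
    (hone : ∀ n, 1 ≤ n → 1 ≤ ‖α n‖)
    (hne : ∀ n, 1 ≤ n → 1 + (b n : ℂ) / α n ≠ 0)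
    (hhouse : ∀ n, 1 ≤ n →
      algHouse (α n) * (b n : ℝ) ≤ ‖α n‖ * (2 : ℝ) ^ ((Real.logb 2 ‖α n‖) ^ a))
    (hmono : MonotoneOn (fun n : ℕ => ‖α n‖) (Set.Ici 1))
    (hgrowth : ∀ᶠ n : ℕ in atTop, (n : ℝ) ^ (1 + ε) < ‖α n‖)
    (hsign : ∀ n, 1 ≤ n → 0 ≤ ((α n / (b n : ℂ)).re + 1 / 2) * e)
    (hstrict : ∃ᶠ n : ℕ in atTop, 0 < ((α n / (b n : ℂ)).re + 1 / 2) * e)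
    (hdiv : ¬ ∃ L : ℝ, Tendsto
      (fun n : ℕ => ‖α n‖ ^ ((1 : ℝ) /
        ((D : ℝ) ^ n * ∏ i ∈ Finset.Ico 1 n, ((totalDeg α i : ℝ) + (relDeg α i : ℝ)))))
      atTop (𝓝 L)) :
    Multipliable (fun n : ℕ => 1 + (b (n + 1) : ℂ) / α (n + 1)) ∧
      (D : ℕ∞) < degOver (unionField α) (∏' n : ℕ, (1 + (b (n + 1) : ℂ) / α (n + 1))) := by
  have hαℚ : ∀ n, 1 ≤ n → IsIntegral ℚ (α n) := fun n hn => (hα n hn).tower_top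
  have hpos : ∀ n, 1 ≤ n → 0 < ‖α n‖ := fun n hn => zero_lt_one.trans_le (hone n hn)
  have hd := one_le_relDeg hαℚ
  set l : ℕ → ℝ := fun n => Real.logb 2 ‖α n‖ with hl
  set β : ℕ → ℝ := fun n => (b n : ℝ) / ‖α n‖ with hβdef
  have hl0 : ∀ n, 1 ≤ n → 0 ≤ l n := fun n hn => Real.logb_nonneg one_lt_two (hone n hn)
  have hlmono : MonotoneOn l (Set.Ici 1) := fun m hm n hn hmn =>
    Real.logb_le_logb_of_le one_lt_two (hpos m hm) (hmono hm hn hmn)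
  have hlgrowth : ∀ᶠ n : ℕ in atTop, (1 + ε) * Real.logb 2 n ≤ l n :=
    eventually_mul_logb_le hgrowth
  have hβ0 : ∀ n, 1 ≤ n → 0 ≤ β n := fun n _ => by positivity
  have hβ : ∀ n, 1 ≤ n → β n ≤ (2 : ℝ) ^ (l n ^ a - l n) := fun n hn =>
    div_norm_le_two_rpow (hα n hn) (hone n hn) (hhouse n hn)
  have hβs : Summable β := summable_of_le_two_rpow hε ha hl0 hlgrowth hβ0 hβ
  set f : ℕ → ℂ := fun n => (b (n + 1) : ℂ) / α (n + 1)
  have hfβ : ∀ n, ‖f n‖ = β (n + 1) := fun n => by simp [f, hβdef]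
  have hf : Summable fun n => ‖f n‖ := by
    simpa only [hfβ] using (summable_nat_add_iff 1).2 hβs
  have hmult : Multipliable fun n => 1 + f n := multipliable_one_add_of_summable hf
  refine ⟨hmult, ?_⟩
  set P := ∏' n, (1 + f n)
  by_contra hcon
  rw [not_lt, degOver] at hcon
  have halg : IsAlgebraic (unionField α) P := by
    by_contra h
    rw [if_neg h] at hcon
    exact absurd hcon (by simp)
  rw [if_pos halg, Nat.cast_le] at hcon
  obtain ⟨C, hC, hliou⟩ := exists_inv_pow_le_norm_sub hα hone hb
    (isAlgebraic_of_isAlgebraic_unionField hαℚ halg)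
  obtain ⟨A, hA, hupper⟩ := norm_tprod_sub_prod_le hf
  have hrange : ∀ N, ∏ n ∈ Finset.range N, (1 + f n) =
      ∏ n ∈ Finset.Icc 1 N, (1 + (b n : ℂ) / α n) := fun N => by
    rw [Finset.range_eq_Ico, ← Finset.Ico_add_one_right_eq_Icc]
    exact Finset.prod_Ico_add' (fun n => 1 + (b n : ℂ) / α n) 0 N 1
  have hsq : ∀ n, 1 ≤ n → (‖1 + (b n : ℂ) / α n‖ ^ 2 - 1) * e =
      2 * ((b n : ℝ) / ‖α n‖) ^ 2 * (((α n / (b n : ℂ)).re + 1 / 2) * e) := fun n hn => by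
    have := norm_one_add_div_sq_sub_one (norm_pos_iff.1 (hpos n hn))
      (r := (b n : ℝ)) (by have := hb n hn; positivity)
    rw [Complex.ofReal_natCast] at this
    rw [this, mul_assoc]
  have hPne : ∀ N, P ≠ ∏ n ∈ Finset.range N, (1 + f n) := by
    refine ne_prod_of_tendsto_prod (e := e) (fun n => hne (n + 1) (by omega)) (fun n => ?_) ?_
      hmult.hasProd.tendsto_prod_nat
    · refine mul_log_nonneg_of_sq he (norm_pos_iff.2 (hne (n + 1) (by omega))) ?_
      rw [hsq (n + 1) (by omega)]
      exact mul_nonneg (by positivity) (hsign (n + 1) (by omega))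
    · rw [frequently_atTop] at hstrict ⊢
      intro M
      obtain ⟨n, hn, hn'⟩ := hstrict (M + 1)
      obtain ⟨m, rfl⟩ : ∃ m, n = m + 1 := ⟨n - 1, by omega⟩
      refine ⟨m, by omega, mul_log_pos_of_sq he (norm_pos_iff.2 (hne (m + 1) (by omega))) ?_⟩
      rw [hsq (m + 1) (by omega)]
      have := hpos (m + 1) (by omega)
      have := hb (m + 1) (by omega)
      exact mul_pos (by positivity) hn'
  have hlow : ∀ᶠ N : ℕ in atTop,
      (2 : ℝ) ^ (-weightSum D (relDeg α)
        (fun n => l n + l n ^ a + Real.logb 2 (2 * (A * C))) N) ≤ ∑' n, β (n + N + 1) := by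
    filter_upwards [eventually_natDegree_minpoly_le halg hcon, hupper, eventually_ge_atTop 1]
      with N hdeg hup hN
    have h1 := hliou N D hdeg (by rw [← hrange]; exact hPne N)
    rw [← hrange] at h1
    have h2 := mul_prod_pow_le_two_rpow (D := D) (N := N) (m := totalDeg α N)
      (h := fun n => algHouse (α n) * b n) (t := fun n => l n + l n ^ a) hN
      (Nat.mul_pos hD (one_le_degProd hd N)) hC hA
      (fun n hn => mul_nonneg ((norm_nonneg _).trans
        (norm_le_algHouse_self (hαℚ n hn).isAlgebraic)) (by positivity))
      (fun n hn => by
        rw [Real.rpow_add two_pos, Real.rpow_logb two_pos (by norm_num) (hpos n hn)]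
        exact hhouse n hn)
    have h3 := h1.trans hup
    simp only [hfβ] at h3
    have hB : 0 < (C * ∏ n ∈ Finset.Icc 1 N, (2 * (algHouse (α n) * b n))) ^
        (D * totalDeg α N) := by
      refine pow_pos (mul_pos (by linarith) (Finset.prod_pos fun n hn => ?_)) _
      have hn1 := (Finset.mem_Icc.1 hn).1
      have h4 : 0 < algHouse (α n) :=
        (hpos n hn1).trans_le (norm_le_algHouse_self (hαℚ n hn1).isAlgebraic)
      have h5 : (0 : ℝ) < b n := by exact_mod_cast hb n hn1
      exact mul_pos two_pos (mul_pos h4 h5)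
    have hA0 : 0 < A := by linarith
    rw [Real.rpow_neg two_pos.le]
    refine (inv_anti₀ (mul_pos hA0 hB) h2).trans ?_
    rw [mul_inv, inv_mul_le_iff₀ hA0]
    exact h3
  have hc : 0 ≤ Real.logb 2 (2 * (A * C)) :=
    Real.logb_nonneg one_lt_two (by nlinarith [one_le_mul_of_one_le_of_one_le hA hC])
  obtain ⟨L, hL⟩ := exists_tendsto_div_growthExp hD hd hε ha hc hl0 hlmono hlgrowth hβ0 hβ hlow
  -- `totalDeg α` unfolds to `degProd (relDeg α)`, so the exponents in `hdiv` agree with `growthExp`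
  -- by definition.
  exact hdiv ⟨_, tendsto_rpow_one_div_of_tendsto_logb hpos hL⟩
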